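/- Theorem (Global convergence of gradient flow, ReLU, asymmetrical node scaling). Let $n,m,d\ge 1$ be integers. Data. Let $\mathbf x_1,\dots,\mathbf x_n\in\mathbb R^d$ and $y_1,\dots,y_n\in\mathbb R$ satisfy $0<\|\mathbf x_i\|\le 1$ and $|y_i|\le C$ for all $i$, with a constant $C>0$, and $\mathbf x_i\ne c\,\mathbf x_{i'}$ for all $i\ne i'$ and $c\in\mathbb R$. Let $\mathbf X$ be the $n\times d$ matrix with rows $\mathbf x_i^\top$. Network. Let $\gamma\in(0,1]$, let $\widetilde\lambda_1\ge\widetilde\lambda_2\ge\dots\ge 0$ with $\sum_{j\ge 1}\widetilde\lambda_j=1$, and put $\lambda_{m,j}=\frac{\gamma}{m}+(1-\gamma)\frac{\widetilde\lambda_j}{\sum_{k=1}^m\widetilde\lambda_k}$ for $1\le j\le m$. Let $\sigma(z)=\max(0,z)$, with weak derivative $\sigma'(z)=\mathbf 1_{\{z>0\}}$. For $\mathbf W=(\mathbf w_1,\dots,\mathbf w_m)\in(\mathbb R^d)^m$ let $Z_j(\mathbf x;\mathbf W)=\mathbf w_j^\top\mathbf x/\sqrt d$, $$f_m(\mathbf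 x;\mathbf W)=\sum_{j=1}^m\sqrt{\lambda_{m,j}}\,a_j\,\sigma(Z_j(\mathbf x;\mathbf W)),\qquad L_m(\mathbf W)=\frac12\sum_{i=1}^n\bigl(y_i-f_m(\mathbf x_i;\mathbf W)\bigr)^2 .$$ The neural tangent Gram matrix $\widehat\Theta_m(\mathbf X;\mathbf W)$ is the $n\times n$ matrix with entries $\frac1d\mathbf x_i^\top\mathbf x_{i'}\sum_{j=1}^m\lambda_{m,j}\,\sigma'(Z_j(\mathbf x_i;\mathbf W))\,\sigma'(Z_j(\mathbf x_{i'};\mathbf W))$. Let $\kappa_n$ be the minimum eigenvalue of the $n\times n$ matrix with entries $\frac1d\mathbf x_i^\top\mathbf x_{i'}\,\mathbb E\bigl[\sigma'(\mathbf w^\top\mathbf x_i/\sqrt d)\,\sigma'(\mathbf w^\top\mathbf x_{i'}/\sqrt d)\bigr]$, where $\mathbf w\sim\mathcal N(0,I_d)$. Initialisation and training. The output weights $a_1,\dots,a_m$ are i.i.d. uniform on $\{-1,1\}$ and fixed during training, the initial weights $\mathbf w_{01},\dots,\mathbf w_{0m}$ are i.i.d. $\mathcal N(0,I_d)$, and the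 two families are independent. A gradient flow is a curve $(\mathbf W_t)_{t\ge0}$, absolutely continuous on every $[0,T]$, that starts at $\mathbf W_0=(\mathbf w_{01},\dots,\mathbf w_{0m})$ and solves $\frac{d\mathbf W_t}{dt}=-\nabla_{\mathbf W}L_m(\mathbf W_t)$ in the following sense: for almost every $t>0$ there are $s_{ij}\in[0,1]$ with $s_{ij}=\sigma'(Z_j(\mathbf x_i;\mathbf W_t))$ whenever $Z_j(\mathbf x_i;\mathbf W_t)\neq0$, such that for every $j$ $$\frac{d\mathbf w_{tj}}{dt}=\sqrt{\lambda_{m,j}}\,\frac{a_j}{\sqrt d}\sum_{i=1}^n s_{ij}\,\bigl(y_i-f_m(\mathbf x_i;\mathbf W_t)\bigr)\,\mathbf x_i .$$ (In particular, every absolutely continuous almost-everywhere solution of the equation with $s_{ij}=\mathbf 1_{\{Z_j(\mathbf x_i;\mathbf W_t)>0\}}$ is a gradient flow.) Claim. Let $\delta\in(0,1)$ and $D_0=\sqrt{2C^2+2/d}$, and assume $$m\ \ge\ \max\left(\frac{2^{3}n\log\frac{4n}{\delta}}{\kappa_n d},\ \frac{2^{25}n^4D_0^2}{\kappa_n^4d^{3}\gamma^2\delta^{5}},\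 \frac{2^{35}n^6D_0^2}{\kappa_n^6d^{5}\gamma^2\delta^{5}}\right).$$ Then there is an event of probability at least $1-\delta$ on which every gradient flow $(\mathbf W_t)_{t\ge 0}$ starting at $\mathbf W_0$ satisfies, for all $t\ge 0$: (a) the minimum eigenvalue of $\widehat\Theta_m(\mathbf X;\mathbf W_t)$ is at least $\frac{\gamma\kappa_n}{4}$; (b) $L_m(\mathbf W_t)\le e^{-(\gamma\kappa_n t)/2}L_m(\mathbf W_0)$; (c) $\|\mathbf w_{tj}-\mathbf w_{0j}\|\le\dfrac{2^3nD_0}{\kappa_nd^{1/2}\gamma\delta^{1/2}}\sqrt{\lambda_{m,j}}$ for all $1\le j\le m$; (d) $\displaystyle\|\widehat\Theta_m(\mathbf X;\mathbf W_t)-\widehat\Theta_m(\mathbf X;\mathbf W_0)\|_2\le\frac{2^9n^2D_0}{\kappa_nd^{3/2}\gamma\delta^{5/2}}\sum_{j=1}^m\lambda_{m,j}^{3/2}+\frac{2^6n^{3/2}D_0^{1/2}}{\kappa_n^{1/2}d^{5/4}\gamma^{1/2}\delta^{5/4}}\sqrt{\sum_{j=1}^m\lambda_{m,j}^{3/2}}$,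 where $\|\cdot\|_2$ is the spectral norm. -/

import Mathlib

open MeasureTheory ProbabilityTheory

noncomputable section

namespace AsymNet

/-- The ReLU activation function `σ(z) = max(0, z)`. -/
def relu (z : ℝ) : ℝ := max 0 z

/-- The weak derivative `σ'(z) = 1_{z > 0}` of the ReLU. -/
def reluDeriv (z : ℝ) : ℝ := if 0 < z then 1 else 0

/-- The admissible values of the derivative of the ReLU at `z`: it is `σ'(z)` if `z ≠ 0`; at the
kink `z = 0`, where the classical derivative does not exist, any value in `[0, 1]` is admissible
(this contains the value `σ'(0) = 0`). -/
def reluSubdiff (z : ℝ) : Set ℝ := if z = 0 then Set.Icc 0 1 else {reluDeriv z}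

/-- The node scalings `λ_{m,j} = γ / m + (1 - γ) λ̃_j / ∑_{k ≤ m} λ̃_k`
(nodes and the sequence `λ̃` are indexed from `0`). -/
def nodeScale (γ : ℝ) (lamT : ℕ → ℝ) (m : ℕ) (j : Fin m) : ℝ :=
  γ * (1 / m) + (1 - γ) * (lamT j / ∑ k : Fin m, lamT k)

variable {n m d : ℕ}

/-- The pre-activation `Z(x; w) = wᵀ x / √d` of a hidden node with weight vector `w`. -/
def preact (w x : EuclideanSpace ℝ (Fin d)) : ℝ := (1 / √(d : ℝ)) * inner ℝ w x

/-- The network output `f_m(x; W) = ∑_j √λ_j a_j σ(Z_j(x; W))`. -/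
def net (lam a : Fin m → ℝ) (W : Fin m → EuclideanSpace ℝ (Fin d))
    (x : EuclideanSpace ℝ (Fin d)) : ℝ :=
  ∑ j, √(lam j) * a j * relu (preact (W j) x)

/-- The empirical risk `L_m(W) = (1/2) ∑_i (y_i - f_m(x_i; W))²`. -/
def loss (lam a : Fin m → ℝ) (X : Fin n → EuclideanSpace ℝ (Fin d)) (y : Fin n → ℝ)
    (W : Fin m → EuclideanSpace ℝ (Fin d)) : ℝ :=
  (1 / 2) * ∑ i, (y i - net lam a W (X i)) ^ 2

/-- The `j`-th block of `-∇_W L_m(W)`, with `s i j` as the derivative of the ReLU at `Z_j(x_i; W)`: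
`√λ_j (a_j / √d) ∑_i s_{ij} (y_i - f_m(x_i; W)) x_i`. -/
def negGrad (lam a : Fin m → ℝ) (X : Fin n → EuclideanSpace ℝ (Fin d)) (y : Fin n → ℝ)
    (W : Fin m → EuclideanSpace ℝ (Fin d)) (s : Fin n → Fin m → ℝ) (j : Fin m) :
    EuclideanSpace ℝ (Fin d) :=
  (√(lam j) * (a j / √(d : ℝ))) • ∑ i, (s i j * (y i - net lam a W (X i))) • X i

/-- `W` solves the gradient flow `dW_t/dt = -∇_W L_m(W_t)` on `[0, ∞)`. As the right-hand side is
discontinuous in `W`, solutions are absolutely continuous curves that satisfy the equation at almost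
every time; if some pre-activation vanishes at that time, the derivative of the ReLU at `0` may be
any number in `[0, 1]`. Taking `s i j = reluDeriv (preact (W t j) (X i))` shows that all
solutions of the equation with `σ'(z) = 1_{z > 0}` are included. -/
structure IsGradientFlow (lam a : Fin m → ℝ) (X : Fin n → EuclideanSpace ℝ (Fin d))
    (y : Fin n → ℝ) (W : ℝ → Fin m → EuclideanSpace ℝ (Fin d)) : Prop where
  absCont : ∀ (j : Fin m) (T : ℝ), 0 ≤ T → AbsolutelyContinuousOnInterval (fun t => W t j) 0 T
  ode : ∀ᵐ t : ℝ, 0 < t → ∃ s : Fin n → Fin m → ℝ,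
    (∀ i j, s i j ∈ reluSubdiff (preact (W t j) (X i))) ∧
    ∀ j, HasDerivAt (fun τ => W τ j) (negGrad lam a X y (W t) s j) t

/-- The neural tangent Gram matrix, with entries
`(1/d) x_iᵀ x_{i'} ∑_j λ_j σ'(Z_j(x_i; W)) σ'(Z_j(x_{i'}; W))`. -/
def ntg (lam : Fin m → ℝ) (X : Fin n → EuclideanSpace ℝ (Fin d))
    (W : Fin m → EuclideanSpace ℝ (Fin d)) : Matrix (Fin n) (Fin n) ℝ :=
  Matrix.of fun i i' => (1 / (d : ℝ)) * inner ℝ (X i) (X i') *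
    ∑ j, lam j * reluDeriv (preact (W j) (X i)) * reluDeriv (preact (W j) (X i'))

/-- The mean neural tangent Gram matrix at initialisation, with entries
`(1/d) x_iᵀ x_{i'} E[σ'(wᵀ x_i / √d) σ'(wᵀ x_{i'} / √d)]` for `w ∼ N(0, I_d)`. -/
def meanNtg (X : Fin n → EuclideanSpace ℝ (Fin d)) : Matrix (Fin n) (Fin n) ℝ :=
  Matrix.of fun i i' => (1 / (d : ℝ)) * inner ℝ (X i) (X i') *
    ∫ w, reluDeriv (preact w (X i)) * reluDeriv (preact w (X i'))
      ∂(stdGaussian (EuclideanSpace ℝ (Fin d)))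

/-- The minimum eigenvalue of a (symmetric) real matrix. -/
def eigMin (A : Matrix (Fin n) (Fin n) ℝ) : ℝ := sInf (spectrum ℝ A)

/-- The spectral norm `‖A‖₂`, the operator norm for the Euclidean norm. -/
def specNorm (A : Matrix (Fin n) (Fin n) ℝ) : ℝ :=
  ‖Matrix.toEuclideanCLM (n := Fin n) (𝕜 := ℝ) A‖

/-- `κ_n`, the minimum eigenvalue of the mean neural tangent Gram matrix. -/
def kappa (X : Fin n → EuclideanSpace ℝ (Fin d)) : ℝ := eigMin (meanNtg X)

/-- The constant `D₀ = √(2 C² + 2 / d)`. -/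
def D0 (C : ℝ) (d : ℕ) : ℝ := √(2 * C ^ 2 + 2 / (d : ℝ))

end AsymNet

end

/-!
Write `r` for the vector of residuals and `Θ` for the neural tangent Gram matrix. Along the flow the
loss has derivative `-rᵀ Θ r` at almost every time (`ae_hasDerivAt_loss`). At a kink of the ReLU
this needs an argument: where `Z` and `σ ∘ Z` are both differentiable and `Z = 0`, both derivatives
vanish, so the chain rule holds with every admissible value of `σ'` (`hasDerivAt_relu_comp`). Hence,
while `Θ ≥ μ := γ κ / 4`, the loss decays like `e^{-2μt}` and the speed of node `j` is at most
`√(λ_j n / d) ‖r‖`, so that its total drift is at most `√(λ_j n / d) ‖r₀‖ / μ`. If `Θ ≥ μ` is known at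
all weights in a product of balls whose radii exceed these drifts, the flow never leaves them
(`flow_stays`).

It remains to control `Θ` near the initial weights. The matrix is `(1/d) ∑_j λ_j F_jᵀ F_j`, where
`F_j v = ∑_i v_i σ'(Z_j(x_i)) x_i`, so Cauchy–Schwarz bounds its change by `(2/d) √(n Φ)`, where `Φ` is the
weighted number of pairs of a node and a data point whose derivative `σ'` changes
(`abs_wgram_sub_bilin_le`). A node that moves by at most `ρ` can only change `σ'` at data points
whose initial pre-activation lies within `ρ ‖x‖` of the kink, and this has Gaussian probability at
most `ρ` (`stdGaussian_abs_inner_le`); Markov's inequality then bounds `Φ`. For the lower bound on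
the eigenvalue this is applied with the equal weights `1/m`: as `λ_j ≥ γ/m`, the matrix `Θ`
dominates `γ` times the equally weighted one, for which the bound is small when `m` is large, even
if some `λ_j` are not. With the weights `λ_j` the same argument gives the bound on the spectral norm.

At initialisation, Chebyshev's inequality for each entry shows that the equally weighted matrix keeps
half of `κ` (`half_kappa_le`); a union bound over the entries is affordable because `κ d ≤ 1`, so
that the required width is of order at least `(n / (κ d))⁶ / δ⁵`. Finally `κ > 0`, since the
functions `w ↦ x_i 1_{wᵀ x_i > 0}` are linearly independent for non-parallel data (`kappa_pos`).
-/

noncomputable section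

namespace AsymNet

variable {n m d : ℕ}

/-! ### Gram matrices of activation patterns, and minimum eigenvalues -/

/-- The Gram matrix `(1/d) x_iᵀ x_{i'} ∑_j q_j s_{ij} s_{i'j}` with node weights `q` and activation
derivatives `s`. It is the neural tangent Gram matrix if `q = λ` and `s i j = σ'(Z_j(x_i))`;
keeping `s` free allows for other values of the derivative at the kink of the ReLU. -/
def wgram (q : Fin m → ℝ) (X : Fin n → EuclideanSpace ℝ (Fin d)) (s : Fin n → Fin m → ℝ) :
    Matrix (Fin n) (Fin n) ℝ :=
  Matrix.of fun i i' => (1 / (d : ℝ)) * inner ℝ (X i) (X i') * ∑ j, q j * s i j * s i' j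

/-- The combination `∑_i v_i s_{ij} x_i` of the data that node `j` sees. -/
def feat (X : Fin n → EuclideanSpace ℝ (Fin d)) (s : Fin n → Fin m → ℝ) (v : Fin n → ℝ)
    (j : Fin m) : EuclideanSpace ℝ (Fin d) :=
  ∑ i, (v i * s i j) • X i

lemma wgram_bilin (q : Fin m → ℝ) (X : Fin n → EuclideanSpace ℝ (Fin d))
    (s : Fin n → Fin m → ℝ) (u v : Fin n → ℝ) :
    u ⬝ᵥ (wgram q X s).mulVec v =
      (1 / (d : ℝ)) * ∑ j, q j * inner ℝ (feat X s u j) (feat X s v j) := by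
  simp only [dotProduct, Matrix.mulVec, wgram, Matrix.of_apply, feat, sum_inner, inner_sum,
    real_inner_smul_left, real_inner_smul_right, Finset.mul_sum, Finset.sum_mul]
  calc _ = ∑ i, ∑ j, ∑ i',
          1 / (d : ℝ) * (q j * (u i * s i j * (v i' * s i' j * inner ℝ (X i) (X i')))) := by
        refine Finset.sum_congr rfl fun i _ => ?_
        rw [Finset.sum_comm]
        exact Finset.sum_congr rfl fun j _ => Finset.sum_congr rfl fun i' _ => by ring
    _ = _ := by
        rw [Finset.sum_comm]
        refine Finset.sum_congr rfl fun j _ => ?_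
        rw [Finset.sum_comm]
        exact Finset.sum_congr rfl fun i' _ => Finset.sum_congr rfl fun i _ => by ring

lemma wgram_isHermitian (q : Fin m → ℝ) (X : Fin n → EuclideanSpace ℝ (Fin d))
    (s : Fin n → Fin m → ℝ) : (wgram q X s).IsHermitian := by
  ext i i'
  simp only [wgram, Matrix.conjTranspose_apply, Matrix.of_apply, star_trivial]
  rw [real_inner_comm]
  simp only [mul_right_comm (q _) (s i _) (s i' _)]

lemma norm_feat_le {X : Fin n → EuclideanSpace ℝ (Fin d)} (hX : ∀ i, ‖X i‖ ≤ 1)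
    (s : Fin n → Fin m → ℝ) (v : Fin n → ℝ) (j : Fin m) :
    ‖feat X s v j‖ ≤ √(∑ i, s i j ^ 2) * √(∑ i, v i ^ 2) := by
  calc ‖feat X s v j‖ ≤ ∑ i, |s i j| * |v i| := by
        refine (norm_sum_le _ _).trans (Finset.sum_le_sum fun i _ => ?_)
        rw [norm_smul, Real.norm_eq_abs, abs_mul, mul_comm |v i|]
        exact mul_le_of_le_one_right (by positivity) (hX i)
    _ ≤ √(∑ i, |s i j| ^ 2) * √(∑ i, |v i| ^ 2) := Real.sum_mul_le_sqrt_mul_sqrt _ _ _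
    _ = _ := by simp only [sq_abs]

lemma feat_sub (X : Fin n → EuclideanSpace ℝ (Fin d)) (s s' : Fin n → Fin m → ℝ)
    (v : Fin n → ℝ) (j : Fin m) :
    feat X s v j - feat X s' v j = feat X (fun i j => s i j - s' i j) v j := by
  simp only [feat, ← Finset.sum_sub_distrib, ← sub_smul, mul_sub]

/-- Perturbation bound for the Gram matrix. Only the quadratic size of the change of the activation
derivatives enters, averaged over the nodes with the weights `q`. -/
lemma abs_wgram_sub_bilin_le {X : Fin n → EuclideanSpace ℝ (Fin d)} (hX : ∀ i, ‖X i‖ ≤ 1)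
    {q : Fin m → ℝ} (hq : ∀ j, 0 ≤ q j) (hq1 : ∑ j, q j ≤ 1) {s s' : Fin n → Fin m → ℝ}
    (hs : ∀ i j, s i j ^ 2 ≤ 1) (hs' : ∀ i j, s' i j ^ 2 ≤ 1) (u v : Fin n → ℝ) :
    |u ⬝ᵥ (wgram q X s).mulVec v - u ⬝ᵥ (wgram q X s').mulVec v| ≤
      2 / d * √(n * ∑ j, q j * ∑ i, (s i j - s' i j) ^ 2) *
        (√(∑ i, u i ^ 2) * √(∑ i, v i ^ 2)) := by
  set U := √(∑ i, u i ^ 2)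
  set V := √(∑ i, v i ^ 2)
  set e : Fin m → ℝ := fun j => ∑ i, (s i j - s' i j) ^ 2
  have he : ∀ j, 0 ≤ e j := fun j => Finset.sum_nonneg fun i _ => sq_nonneg _
  have hbd : ∀ (r : Fin n → Fin m → ℝ), (∀ i j, r i j ^ 2 ≤ 1) → ∀ j,
      ∑ i, r i j ^ 2 ≤ n := fun r hr j => by
    refine (Finset.sum_le_sum fun i _ => hr i j).trans ?_
    simp
  have hnode : ∀ j, |inner ℝ (feat X s u j) (feat X s v j) -
      inner ℝ (feat X s' u j) (feat X s' v j)| ≤ 2 * (√n * √(e j) * (U * V)) := fun j => by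
    have h1 : inner ℝ (feat X s u j) (feat X s v j) - inner ℝ (feat X s' u j) (feat X s' v j) =
        inner ℝ (feat X s u j - feat X s' u j) (feat X s v j) +
          inner ℝ (feat X s' u j) (feat X s v j - feat X s' v j) := by
      rw [inner_sub_left, inner_sub_right]; ring
    rw [h1, feat_sub, feat_sub]
    refine (abs_add_le _ _).trans ?_
    have a1 : |inner ℝ (feat X (fun i j => s i j - s' i j) u j) (feat X s v j)| ≤
        (√(e j) * U) * (√n * V) :=
      (abs_real_inner_le_norm _ _).trans (mul_le_mul (norm_feat_le hX _ _ _)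
        ((norm_feat_le hX _ _ _).trans (by gcongr; exact hbd s hs j)) (norm_nonneg _)
        (by positivity))
    have a2 : |inner ℝ (feat X s' u j) (feat X (fun i j => s i j - s' i j) v j)| ≤
        (√n * U) * (√(e j) * V) :=
      (abs_real_inner_le_norm _ _).trans (mul_le_mul
        ((norm_feat_le hX _ _ _).trans (by gcongr; exact hbd s' hs' j))
        (norm_feat_le hX _ _ _) (norm_nonneg _) (by positivity))
    linarith
  -- Cauchy–Schwarz with respect to the weights `q`, of total mass at most one
  have hcs : ∑ j, q j * √(e j) ≤ √(∑ j, q j * e j) := by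
    calc ∑ j, q j * √(e j) = ∑ j, √(q j) * √(q j * e j) := by
          refine Finset.sum_congr rfl fun j _ => ?_
          rw [Real.sqrt_mul (hq j), ← mul_assoc, Real.mul_self_sqrt (hq j)]
      _ ≤ √(∑ j, √(q j) ^ 2) * √(∑ j, √(q j * e j) ^ 2) := Real.sum_mul_le_sqrt_mul_sqrt _ _ _
      _ = √(∑ j, q j) * √(∑ j, q j * e j) := by
          congr 2
          · exact Finset.sum_congr rfl fun j _ => Real.sq_sqrt (hq j)
          · exact Finset.sum_congr rfl fun j _ => Real.sq_sqrt (mul_nonneg (hq j) (he j))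
      _ ≤ 1 * √(∑ j, q j * e j) := by
          gcongr
          exact Real.sqrt_le_one.2 hq1
      _ = _ := one_mul _
  rw [wgram_bilin, wgram_bilin, ← mul_sub, ← Finset.sum_sub_distrib, abs_mul,
    abs_of_nonneg (by positivity : (0 : ℝ) ≤ 1 / d)]
  calc 1 / (d : ℝ) * |∑ j, (q j * inner ℝ (feat X s u j) (feat X s v j) -
        q j * inner ℝ (feat X s' u j) (feat X s' v j))|
      ≤ 1 / d * ∑ j, q j * (2 * (√n * √(e j) * (U * V))) := by
        gcongr
        refine (Finset.abs_sum_le_sum_abs _ _).trans (Finset.sum_le_sum fun j _ => ?_)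
        rw [← mul_sub, abs_mul, abs_of_nonneg (hq j)]
        exact mul_le_mul_of_nonneg_left (hnode j) (hq j)
    _ = 2 / d * (√n * ∑ j, q j * √(e j)) * (U * V) := by
        simp only [Finset.mul_sum, Finset.sum_mul]
        exact Finset.sum_congr rfl fun j _ => by ring
    _ ≤ 2 / d * (√n * √(∑ j, q j * e j)) * (U * V) := by gcongr
    _ = _ := by rw [Real.sqrt_mul (Nat.cast_nonneg n)]

lemma mul_wgram_le {q q' : Fin m → ℝ} {γ : ℝ} (h : ∀ j, γ * q' j ≤ q j)
    (X : Fin n → EuclideanSpace ℝ (Fin d)) (s : Fin n → Fin m → ℝ) (v : Fin n → ℝ) :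
    γ * (v ⬝ᵥ (wgram q' X s).mulVec v) ≤ v ⬝ᵥ (wgram q X s).mulVec v := by
  rw [wgram_bilin, wgram_bilin, mul_left_comm, Finset.mul_sum]
  refine mul_le_mul_of_nonneg_left (Finset.sum_le_sum fun j _ => ?_) (by positivity)
  rw [← mul_assoc]
  exact mul_le_mul_of_nonneg_right (h j) real_inner_self_nonneg

lemma le_eigMin (hn : 1 ≤ n) {A : Matrix (Fin n) (Fin n) ℝ} (hA : A.IsHermitian) {c : ℝ}
    (h : ∀ v : Fin n → ℝ, c * ∑ i, v i ^ 2 ≤ v ⬝ᵥ A.mulVec v) : c ≤ eigMin A := by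
  have : Nonempty (Fin n) := ⟨⟨0, hn⟩⟩
  rw [eigMin, hA.spectrum_real_eq_range_eigenvalues]
  refine le_csInf (Set.range_nonempty _) ?_
  rintro _ ⟨i, rfl⟩
  have h1 := h (hA.eigenvectorBasis i)
  have h2 : ∑ k, (hA.eigenvectorBasis i) k ^ 2 = 1 := by
    rw [← EuclideanSpace.real_norm_sq_eq, hA.eigenvectorBasis.orthonormal.1 i, one_pow]
  rw [h2, mul_one] at h1
  rw [hA.eigenvalues_eq]
  simpa using h1

lemma eigMin_mul_le {A : Matrix (Fin n) (Fin n) ℝ} (hA : A.IsHermitian) (v : Fin n → ℝ) :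
    eigMin A * ∑ i, v i ^ 2 ≤ v ⬝ᵥ A.mulVec v := by
  have hsp : (A - eigMin A • (1 : Matrix (Fin n) (Fin n) ℝ)).PosSemidef := by
    rw [Matrix.posSemidef_iff_isHermitian_and_spectrum_nonneg]
    constructor
    · exact hA.sub (by simp [Matrix.IsHermitian])
    · intro a ha
      have h1 : a + eigMin A ∈ spectrum ℝ A := by
        rw [← Algebra.algebraMap_eq_smul_one, spectrum.mem_iff] at ha
        rw [spectrum.mem_iff]
        convert ha using 2
        rw [map_add]; abel
      have h2 : eigMin A ≤ a + eigMin A := by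
        refine csInf_le ?_ h1
        rw [hA.spectrum_real_eq_range_eigenvalues]
        exact (Set.finite_range _).bddBelow
      simpa using h2
  have h := hsp.dotProduct_mulVec_nonneg v
  simp only [star_trivial, Matrix.sub_mulVec, Matrix.smul_mulVec, Matrix.one_mulVec,
    dotProduct_sub, dotProduct_smul, smul_eq_mul] at h
  have h3 : v ⬝ᵥ v = ∑ i, v i ^ 2 := by simp [dotProduct, sq]
  rw [h3] at h
  linarith

lemma specNorm_le {A : Matrix (Fin n) (Fin n) ℝ} {c : ℝ} (hc : 0 ≤ c)
    (h : ∀ u v : Fin n → ℝ, u ⬝ᵥ A.mulVec v ≤ c * (√(∑ i, u i ^ 2) * √(∑ i, v i ^ 2))) :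
    specNorm A ≤ c := by
  refine ContinuousLinearMap.opNorm_le_bound _ hc fun v => ?_
  set w := Matrix.toEuclideanCLM (n := Fin n) (𝕜 := ℝ) A v
  have hw : ‖w‖ * ‖w‖ ≤ c * (‖w‖ * ‖v‖) := by
    have h1 := h w.ofLp v.ofLp
    rw [← EuclideanSpace.real_norm_sq_eq, ← EuclideanSpace.real_norm_sq_eq,
      Real.sqrt_sq (norm_nonneg _), Real.sqrt_sq (norm_nonneg _)] at h1
    refine le_trans (le_of_eq ?_) h1
    rw [← Matrix.ofLp_toEuclideanCLM, ← real_inner_self_eq_norm_mul_norm,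
      EuclideanSpace.inner_eq_star_dotProduct]
    simp [w]
  rcases (norm_nonneg w).eq_or_lt with h0 | h0
  · rw [← h0]; positivity
  · nlinarith

lemma reluDeriv_mem (z : ℝ) : reluDeriv z ∈ Set.Icc (0 : ℝ) 1 := by
  unfold reluDeriv; split_ifs <;> simp

lemma reluSubdiff_subset (z : ℝ) : reluSubdiff z ⊆ Set.Icc 0 1 := by
  unfold reluSubdiff
  split_ifs
  · exact subset_rfl
  · simpa using reluDeriv_mem z

lemma reluDeriv_mem_reluSubdiff (z : ℝ) : reluDeriv z ∈ reluSubdiff z := by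
  unfold reluSubdiff
  split_ifs
  · exact reluDeriv_mem z
  · rfl

/-- A change of the weight by at most `ρ` cannot alter the activation derivative unless the
initial pre-activation lies within `ρ ‖x‖` of the kink. -/
lemma sq_sub_reluDeriv_le {w w' x : EuclideanSpace ℝ (Fin d)} (hd : 1 ≤ d) {ρ s : ℝ}
    (h : ‖w' - w‖ ≤ ρ) (hs : s ∈ reluSubdiff (preact w' x)) :
    (s - reluDeriv (preact w x)) ^ 2 ≤ if |inner ℝ w x| ≤ ρ * ‖x‖ then 1 else 0 := by
  have hd' : (0 : ℝ) < 1 / √(d : ℝ) := by positivity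
  have h0 := reluDeriv_mem (preact w x)
  have h1 := reluSubdiff_subset _ hs
  split_ifs with hf
  · rw [sq_le_one_iff_abs_le_one, abs_le]
    constructor <;> linarith [h0.1, h0.2, h1.1, h1.2]
  · push Not at hf
    have h2 : |inner ℝ w' x - inner ℝ w x| ≤ ρ * ‖x‖ := by
      rw [← inner_sub_left]
      exact (abs_real_inner_le_norm _ _).trans (by gcongr)
    have h3 := abs_le.1 h2
    have key : s = reluDeriv (preact w x) := by
      unfold preact reluSubdiff reluDeriv at *
      rcases lt_abs.1 hf with h4 | h4
      · have p1 : 0 < inner ℝ w' x := by linarith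
        have p2 : 0 < inner ℝ w x := by
          have : 0 ≤ ρ * ‖x‖ := (abs_nonneg _).trans h2
          linarith
        have q1 := mul_pos hd' p1
        have q2 := mul_pos hd' p2
        rw [if_neg q1.ne', if_pos q1] at hs
        rw [if_pos q2]
        exact hs
      · have p1 : inner ℝ w' x < 0 := by linarith
        have p2 : inner ℝ w x < 0 := by
          have : 0 ≤ ρ * ‖x‖ := (abs_nonneg _).trans h2
          linarith
        have q1 := mul_neg_of_pos_of_neg hd' p1
        have q2 := mul_neg_of_pos_of_neg hd' p2
        rw [if_neg q1.ne, if_neg q1.le.not_gt] at hs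
        rw [if_neg q2.le.not_gt]
        exact hs
    rw [key]; simp

/-! ### Gradient flow: decay of the loss and confinement of the weights -/

lemma absCont_sum {ι : Type*} (S : Finset ι) {f : ι → ℝ → ℝ} {a b : ℝ}
    (hf : ∀ i ∈ S, AbsolutelyContinuousOnInterval (f i) a b) :
    AbsolutelyContinuousOnInterval (fun t => ∑ i ∈ S, f i t) a b := by
  classical
  induction S using Finset.induction_on with
  | empty =>
    simpa using (LipschitzWith.const (0 : ℝ)).lipschitzOnWith.absolutelyContinuousOnInterval
  | insert i S hi ih =>
    simp only [Finset.sum_insert hi]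
    exact (hf i (Finset.mem_insert_self _ _)).add
      (ih fun j hj => hf j (Finset.mem_insert_of_mem hj))

lemma absCont_of_dist_le {E F : Type*} [PseudoMetricSpace E] [PseudoMetricSpace F]
    {f : ℝ → E} {g : ℝ → F} {a b : ℝ} (K : ℝ)
    (hf : AbsolutelyContinuousOnInterval f a b)
    (h : ∀ t t', dist (g t) (g t') ≤ K * dist (f t) (f t')) :
    AbsolutelyContinuousOnInterval g a b := by
  apply squeeze_zero (fun t ↦ ?_) (fun t ↦ ?_) (by simpa using Filter.Tendsto.const_mul K hf)
  · exact Finset.sum_nonneg (fun i hi ↦ by positivity)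
  · rw [Finset.mul_sum]
    exact Finset.sum_le_sum fun i _ => h _ _

lemma absCont_relu {f : ℝ → ℝ} {a b : ℝ} (hf : AbsolutelyContinuousOnInterval f a b) :
    AbsolutelyContinuousOnInterval (fun t => relu (f t)) a b :=
  absCont_of_dist_le 1 hf fun t t' => by
    rw [one_mul, Real.dist_eq, Real.dist_eq]
    have := abs_max_sub_max_le_max 0 (f t) 0 (f t')
    simpa [relu] using this

lemma absCont_inner {f : ℝ → EuclideanSpace ℝ (Fin d)} {a b : ℝ}
    (hf : AbsolutelyContinuousOnInterval f a b) (x : EuclideanSpace ℝ (Fin d)) :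
    AbsolutelyContinuousOnInterval (fun t => inner ℝ (f t) x) a b :=
  absCont_of_dist_le ‖x‖ hf fun t t' => by
    rw [Real.dist_eq, ← inner_sub_left, dist_eq_norm, mul_comm]
    exact abs_real_inner_le_norm _ _

lemma absCont_exp (c a b : ℝ) : AbsolutelyContinuousOnInterval (fun t => Real.exp (c * t)) a b :=
  ContDiffOn.absolutelyContinuousOnInterval (ContDiff.contDiffOn (by fun_prop))

lemma absCont_const (c a b : ℝ) : AbsolutelyContinuousOnInterval (fun _ => c) a b :=
  (LipschitzWith.const c).lipschitzOnWith.absolutelyContinuousOnInterval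

/-- An absolutely continuous function with nonpositive derivative almost everywhere does not
increase. -/
lemma le_of_ae_deriv_nonpos {φ : ℝ → ℝ} {T : ℝ} (hT : 0 ≤ T)
    (hφ : AbsolutelyContinuousOnInterval φ 0 T)
    (h : ∀ᵐ t : ℝ, t ∈ Set.Ioo 0 T → ∃ c ≤ 0, HasDerivAt φ c t) : φ T ≤ φ 0 := by
  have h1 := hφ.integral_deriv_eq_sub
  have h2 : ∫ t in (0 : ℝ)..T, deriv φ t ≤ 0 := by
    rw [intervalIntegral.integral_of_le hT, integral_Ioc_eq_integral_Ioo]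
    refine integral_nonpos_of_ae ?_
    rw [Filter.EventuallyLE, ae_restrict_iff' measurableSet_Ioo]
    filter_upwards [h] with t ht hm
    obtain ⟨c, hc, hd⟩ := ht hm
    rw [hd.deriv]; exact hc
  linarith

/-- The chain rule for the ReLU holds with any admissible value of its derivative, wherever both
sides are differentiable: at a kink, `σ ∘ Z` and `σ ∘ (-Z) = σ ∘ Z - Z` both have a minimum, so
both derivatives vanish. -/
lemma hasDerivAt_relu_comp {Z : ℝ → ℝ} {z t s : ℝ} (hZ : HasDerivAt Z z t)
    (hr : DifferentiableAt ℝ (fun τ => relu (Z τ)) t) (hs : s ∈ reluSubdiff (Z t)) :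
    HasDerivAt (fun τ => relu (Z τ)) (s * z) t := by
  unfold reluSubdiff at hs
  rcases lt_trichotomy (Z t) 0 with h | h | h
  · rw [if_neg h.ne, reluDeriv, if_neg h.le.not_gt] at hs
    rw [Set.mem_singleton_iff.1 hs, zero_mul]
    refine (hasDerivAt_const t (0 : ℝ)).congr_of_eventuallyEq ?_
    filter_upwards [hZ.continuousAt.eventually_lt_const h] with τ hτ
    exact max_eq_left hτ.le
  · have h1 := hr.hasDerivAt
    have h2 : deriv (fun τ => relu (Z τ)) t = 0 := by
      refine IsLocalMin.hasDerivAt_eq_zero (Filter.Eventually.of_forall fun τ => ?_) h1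
      simp [relu, h]
    have h3 : deriv (fun τ => relu (Z τ)) t - z = 0 := by
      refine IsLocalMin.hasDerivAt_eq_zero (f := fun τ => relu (Z τ) - Z τ)
        (Filter.Eventually.of_forall fun τ => ?_) (h1.sub hZ)
      simp [relu, h]
    have hz : z = 0 := by linarith
    rw [hz, mul_zero, ← h2]
    exact h1
  · rw [if_neg h.ne', reluDeriv, if_pos h] at hs
    rw [Set.mem_singleton_iff.1 hs, one_mul]
    refine hZ.congr_of_eventuallyEq ?_
    filter_upwards [hZ.continuousAt.eventually_const_lt h] with τ hτ
    exact max_eq_right hτ.le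

/-- The residuals `y_i - f_m(x_i; W)`. -/
def resid (lam a : Fin m → ℝ) (X : Fin n → EuclideanSpace ℝ (Fin d)) (y : Fin n → ℝ)
    (W : Fin m → EuclideanSpace ℝ (Fin d)) (i : Fin n) : ℝ := y i - net lam a W (X i)

lemma loss_eq (lam a : Fin m → ℝ) (X : Fin n → EuclideanSpace ℝ (Fin d)) (y : Fin n → ℝ)
    (W : Fin m → EuclideanSpace ℝ (Fin d)) :
    loss lam a X y W = (1 / 2) * ∑ i, resid lam a X y W i ^ 2 := rfl

lemma negGrad_eq (lam a : Fin m → ℝ) (X : Fin n → EuclideanSpace ℝ (Fin d)) (y : Fin n → ℝ)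
    (W : Fin m → EuclideanSpace ℝ (Fin d)) (s : Fin n → Fin m → ℝ) (j : Fin m) :
    negGrad lam a X y W s j =
      (√(lam j) * (a j / √(d : ℝ))) • feat X s (resid lam a X y W) j := by
  simp only [negGrad, feat, resid, mul_comm (s _ _)]

lemma absCont_resid {lam a : Fin m → ℝ} {X : Fin n → EuclideanSpace ℝ (Fin d)} {y : Fin n → ℝ}
    {W : ℝ → Fin m → EuclideanSpace ℝ (Fin d)} (hW : IsGradientFlow lam a X y W) {T : ℝ}
    (hT : 0 ≤ T) (i : Fin n) :
    AbsolutelyContinuousOnInterval (fun t => resid lam a X y (W t) i) 0 T :=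
  (absCont_const (y i) 0 T).sub (absCont_sum _ fun j _ => (absCont_relu
    ((absCont_inner (hW.absCont j T hT) (X i)).const_mul _)).const_mul _)

lemma absCont_loss {lam a : Fin m → ℝ} {X : Fin n → EuclideanSpace ℝ (Fin d)} {y : Fin n → ℝ}
    {W : ℝ → Fin m → EuclideanSpace ℝ (Fin d)} (hW : IsGradientFlow lam a X y W) {T : ℝ}
    (hT : 0 ≤ T) : AbsolutelyContinuousOnInterval (fun t => loss lam a X y (W t)) 0 T := by
  simp only [loss_eq, sq]
  exact (absCont_sum _ fun i _ => (absCont_resid hW hT i).mul (absCont_resid hW hT i)).const_mul _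

/-- Along a gradient flow the loss has derivative `- rᵀ Θ r` at almost every time, where `r` is the
residual and `Θ` the Gram matrix of the activation derivatives that the flow selects. -/
lemma ae_hasDerivAt_loss {lam a : Fin m → ℝ} {X : Fin n → EuclideanSpace ℝ (Fin d)}
    {y : Fin n → ℝ} {W : ℝ → Fin m → EuclideanSpace ℝ (Fin d)} (hlam : ∀ j, 0 ≤ lam j)
    (ha : ∀ j, a j ^ 2 = 1) (hW : IsGradientFlow lam a X y W) {T : ℝ} (hT : 0 ≤ T) :
    ∀ᵐ t : ℝ, t ∈ Set.Ioo 0 T → ∃ s : Fin n → Fin m → ℝ,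
      (∀ i j, s i j ∈ reluSubdiff (preact (W t j) (X i))) ∧
      HasDerivAt (fun τ => loss lam a X y (W τ))
        (-(resid lam a X y (W t) ⬝ᵥ (wgram lam X s).mulVec (resid lam a X y (W t)))) t := by
  have hdiff : ∀ᵐ t : ℝ, ∀ i j, t ∈ Set.uIcc 0 T →
      DifferentiableAt ℝ (fun τ => relu (preact (W τ j) (X i))) t := by
    rw [ae_all_iff]; intro i
    rw [ae_all_iff]; intro j
    exact AbsolutelyContinuousOnInterval.ae_differentiableAt
      (absCont_relu ((absCont_inner (hW.absCont j T hT) (X i)).const_mul _))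
  filter_upwards [hW.ode, hdiff] with t hode hdf htT
  obtain ⟨s, hs, hder⟩ := hode htT.1
  refine ⟨s, hs, ?_⟩
  set r := resid lam a X y (W t) with hr
  have hrelu : ∀ i j, HasDerivAt (fun τ => relu (preact (W τ j) (X i)))
      (s i j * ((1 / √(d : ℝ)) * inner ℝ (negGrad lam a X y (W t) s j) (X i))) t := by
    intro i j
    refine hasDerivAt_relu_comp ?_ (hdf i j ?_) (hs i j)
    · refine HasDerivAt.const_mul _ ?_
      simpa using (hder j).inner ℝ (hasDerivAt_const t (X i))
    · rw [Set.uIcc_of_le hT]; exact ⟨htT.1.le, htT.2.le⟩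
  have hres : ∀ i, HasDerivAt (fun τ => resid lam a X y (W τ) i)
      (-∑ j, √(lam j) * a j *
        (s i j * ((1 / √(d : ℝ)) * inner ℝ (negGrad lam a X y (W t) s j) (X i)))) t := by
    intro i
    exact (HasDerivAt.fun_sum fun j _ => (hrelu i j).const_mul (√(lam j) * a j)).const_sub (y i)
  have hloss := (HasDerivAt.fun_sum fun i (_ : i ∈ Finset.univ) =>
    (hres i).pow 2).const_mul (1 / 2 : ℝ)
  refine hloss.congr_deriv ?_
  rw [wgram_bilin]
  have hfeat : ∀ j, inner ℝ (feat X s r j) (feat X s r j) =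
      ∑ i, r i * s i j * inner ℝ (feat X s r j) (X i) := by
    intro j
    conv_lhs => rw [feat, sum_inner]
    refine Finset.sum_congr rfl fun i _ => ?_
    rw [real_inner_smul_left, real_inner_comm]; rfl
  simp only [hfeat, negGrad_eq, real_inner_smul_left, Finset.mul_sum, ← Finset.sum_neg_distrib]
  rw [Finset.sum_comm]
  refine Finset.sum_congr rfl fun j _ => Finset.sum_congr rfl fun i _ => ?_
  have e1 : √(lam j) * √(lam j) = lam j := Real.mul_self_sqrt (hlam j)
  have e2 : (1 / √(d : ℝ)) * (1 / √(d : ℝ)) = 1 / d := by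
    rw [div_mul_div_comm, one_mul, Real.mul_self_sqrt (Nat.cast_nonneg d)]
  rw [← hr]
  linear_combination (-(√(lam j) * √(lam j) * (1 / √(d : ℝ) * (1 / √(d : ℝ))) * r i * s i j *
    inner ℝ (feat X s r j) (X i))) * ha j - (1 / √(d : ℝ) * (1 / √(d : ℝ)) * r i * s i j *
    inner ℝ (feat X s r j) (X i)) * e1 - (lam j * r i * s i j *
    inner ℝ (feat X s r j) (X i)) * e2

/-- As long as the Gram matrix of the flow stays above `μ`, the loss decays like `e^{-2μt}`. -/
lemma loss_le_exp {lam a : Fin m → ℝ} {X : Fin n → EuclideanSpace ℝ (Fin d)}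
    {y : Fin n → ℝ} {W : ℝ → Fin m → EuclideanSpace ℝ (Fin d)} (hlam : ∀ j, 0 ≤ lam j)
    (ha : ∀ j, a j ^ 2 = 1) (hW : IsGradientFlow lam a X y W) {T μ : ℝ} (hT : 0 ≤ T)
    (hμ : ∀ t ∈ Set.Ioo 0 T, ∀ s : Fin n → Fin m → ℝ,
      (∀ i j, s i j ∈ reluSubdiff (preact (W t j) (X i))) →
      ∀ v : Fin n → ℝ, μ * ∑ i, v i ^ 2 ≤ v ⬝ᵥ (wgram lam X s).mulVec v) :
    loss lam a X y (W T) ≤ Real.exp (-(2 * μ) * T) * loss lam a X y (W 0) := by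
  have key := le_of_ae_deriv_nonpos hT
    ((absCont_exp (2 * μ) 0 T).mul (absCont_loss (a := a) (X := X) (y := y) hW hT)) (by
      filter_upwards [ae_hasDerivAt_loss hlam ha hW hT] with t ht htT
      obtain ⟨s, hs, hder⟩ := ht htT
      have hexp : HasDerivAt (fun t => Real.exp (2 * μ * t)) (Real.exp (2 * μ * t) * (2 * μ)) t := by
        simpa using ((hasDerivAt_id t).const_mul (2 * μ)).exp
      refine ⟨_, ?_, hexp.mul hder⟩
      have h1 := hμ t htT s hs (resid lam a X y (W t))
      rw [loss_eq]
      have h2 := Real.exp_pos (2 * μ * t)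
      nlinarith)
  simp only [Pi.mul_apply, mul_zero, Real.exp_zero, one_mul] at key
  rw [neg_mul, Real.exp_neg, inv_mul_eq_div, le_div_iff₀ (Real.exp_pos _), mul_comm]
  exact key

lemma norm_negGrad_le {lam a : Fin m → ℝ} {X : Fin n → EuclideanSpace ℝ (Fin d)}
    (hX : ∀ i, ‖X i‖ ≤ 1) (y : Fin n → ℝ) (ha : ∀ j, a j ^ 2 = 1)
    (W : Fin m → EuclideanSpace ℝ (Fin d)) {s : Fin n → Fin m → ℝ} (hs : ∀ i j, s i j ^ 2 ≤ 1)
    (j : Fin m) :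
    ‖negGrad lam a X y W s j‖ ≤ √(lam j) * √n / √d * √(2 * loss lam a X y W) := by
  have ha' : |a j| = 1 := by
    rw [← sq_eq_sq₀ (abs_nonneg _) zero_le_one, sq_abs, ha j, one_pow]
  have h2 : 2 * loss lam a X y W = ∑ i, resid lam a X y W i ^ 2 := by rw [loss_eq]; ring
  have h3 : √(∑ i, s i j ^ 2) ≤ √n := by
    refine Real.sqrt_le_sqrt ((Finset.sum_le_sum fun i _ => hs i j).trans ?_)
    simp
  rw [negGrad_eq, norm_smul, Real.norm_eq_abs, abs_mul, abs_div, ha', h2,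
    abs_of_nonneg (Real.sqrt_nonneg _), abs_of_nonneg (Real.sqrt_nonneg _)]
  calc √(lam j) * (1 / √d) * ‖feat X s (resid lam a X y W) j‖
      ≤ √(lam j) * (1 / √d) * (√n * √(∑ i, resid lam a X y W i ^ 2)) := by
        gcongr
        exact (norm_feat_le hX _ _ _).trans (by gcongr)
    _ = _ := by ring

/-- As long as the Gram matrix of the flow stays above `μ`, the length of the path of node `j` is
controlled by the integral of the residual, which decays like `e^{-μt}`. -/
lemma norm_drift_le {lam a : Fin m → ℝ} {X : Fin n → EuclideanSpace ℝ (Fin d)}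
    (hX : ∀ i, ‖X i‖ ≤ 1)
    {y : Fin n → ℝ} {W : ℝ → Fin m → EuclideanSpace ℝ (Fin d)} (hlam : ∀ j, 0 ≤ lam j)
    (ha : ∀ j, a j ^ 2 = 1) (hW : IsGradientFlow lam a X y W) {T μ : ℝ} (hT : 0 ≤ T) (hμ0 : 0 < μ)
    (hμ : ∀ t ∈ Set.Ioo 0 T, ∀ s : Fin n → Fin m → ℝ,
      (∀ i j, s i j ∈ reluSubdiff (preact (W t j) (X i))) →
      ∀ v : Fin n → ℝ, μ * ∑ i, v i ^ 2 ≤ v ⬝ᵥ (wgram lam X s).mulVec v) (j : Fin m) :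
    ‖W T j - W 0 j‖ ≤ √(lam j) * √n / √d * √(2 * loss lam a X y (W 0)) / μ := by
  -- testing with the drift `u` itself: the function `⟪W t j, u⟫ + K ‖u‖ e^{-μt} / μ` does not increase
  set u := W T j - W 0 j with hu
  set K := √(lam j) * √n / √d * √(2 * loss lam a X y (W 0)) with hK
  have hK0 : 0 ≤ K := by positivity
  have key := le_of_ae_deriv_nonpos hT
    ((absCont_inner (hW.absCont j T hT) u).add ((absCont_exp (-μ) 0 T).const_mul (K * ‖u‖ / μ))) (by
      filter_upwards [hW.ode] with t ht htT
      obtain ⟨s, hs, hder⟩ := ht htT.1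
      have hexp : HasDerivAt (fun t => Real.exp (-μ * t)) (Real.exp (-μ * t) * (-μ)) t := by
        simpa using ((hasDerivAt_id t).const_mul (-μ)).exp
      have hin : HasDerivAt (fun t => inner ℝ (W t j) u)
          (inner ℝ (negGrad lam a X y (W t) s j) u) t := by
        simpa using (hder j).inner ℝ (hasDerivAt_const t u)
      refine ⟨_, ?_, hin.add (hexp.const_mul (K * ‖u‖ / μ))⟩
      have hsq : ∀ i j, s i j ^ 2 ≤ 1 := fun i j => by
        have := reluSubdiff_subset _ (hs i j)
        nlinarith [this.1, this.2]
      have hl : √(2 * loss lam a X y (W t)) ≤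
          Real.exp (-μ * t) * √(2 * loss lam a X y (W 0)) := by
        have h1 := loss_le_exp hlam ha hW htT.1.le
          (fun t' ht' => hμ t' ⟨ht'.1, ht'.2.trans htT.2⟩)
        rw [Real.sqrt_le_left (by positivity), mul_pow, Real.sq_sqrt, ← Real.exp_nat_mul]
        · calc _ ≤ 2 * (Real.exp (-(2 * μ) * t) * loss lam a X y (W 0)) := by gcongr
            _ = _ := by
              rw [show ((2 : ℕ) : ℝ) * (-μ * t) = -(2 * μ) * t by push_cast; ring]; ring
        · rw [loss_eq]; positivity
      have h2 : inner ℝ (negGrad lam a X y (W t) s j) u ≤ K * Real.exp (-μ * t) * ‖u‖ := by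
        refine (real_inner_le_norm _ _).trans ?_
        gcongr
        refine (norm_negGrad_le hX y ha (W t) hsq j).trans ?_
        calc _ ≤ √(lam j) * √n / √d * (Real.exp (-μ * t) * √(2 * loss lam a X y (W 0))) := by
              gcongr
          _ = _ := by rw [hK]; ring
      have h3 : K * ‖u‖ / μ * (Real.exp (-μ * t) * -μ) = -(K * Real.exp (-μ * t) * ‖u‖) := by
        field_simp
      rw [h3]
      linarith)
  simp only [Pi.add_apply, mul_zero, Real.exp_zero, mul_one] at key
  have h1 : ‖u‖ * ‖u‖ = inner ℝ (W T j) u - inner ℝ (W 0 j) u := by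
    rw [← inner_sub_left, ← hu, real_inner_self_eq_norm_mul_norm]
  have h2 : 0 ≤ K * ‖u‖ / μ * Real.exp (-μ * T) := by positivity
  have h3 : ‖u‖ * ‖u‖ ≤ K / μ * ‖u‖ := by
    calc _ ≤ K * ‖u‖ / μ := by linarith
      _ = _ := by ring
  rcases (norm_nonneg u).eq_or_lt with h0 | h0
  · rw [← h0]; positivity
  · exact le_of_mul_le_mul_right h3 h0

/-- The bootstrap argument. If the Gram matrix is at least `μ` at all weights within distance `ρ`
of the initial ones, and the resulting bound on the drift is strictly smaller than `ρ`, then the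
flow can never leave this neighbourhood. -/
theorem flow_stays {lam a : Fin m → ℝ} {X : Fin n → EuclideanSpace ℝ (Fin d)}
    (hX : ∀ i, ‖X i‖ ≤ 1)
    {y : Fin n → ℝ} {W : ℝ → Fin m → EuclideanSpace ℝ (Fin d)} (hlam : ∀ j, 0 ≤ lam j)
    (ha : ∀ j, a j ^ 2 = 1) (hW : IsGradientFlow lam a X y W) {μ : ℝ} (hμ0 : 0 < μ)
    {ρ : Fin m → ℝ}
    (hρ : ∀ j, √(lam j) * √n / √d * √(2 * loss lam a X y (W 0)) / μ < ρ j)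
    (hμ : ∀ W' : Fin m → EuclideanSpace ℝ (Fin d), (∀ j, ‖W' j - W 0 j‖ ≤ ρ j) →
      ∀ s : Fin n → Fin m → ℝ, (∀ i j, s i j ∈ reluSubdiff (preact (W' j) (X i))) →
      ∀ v : Fin n → ℝ, μ * ∑ i, v i ^ 2 ≤ v ⬝ᵥ (wgram lam X s).mulVec v) {T : ℝ} (hT : 0 ≤ T) :
    (∀ j, ‖W T j - W 0 j‖ ≤ ρ j) ∧
      loss lam a X y (W T) ≤ Real.exp (-(2 * μ) * T) * loss lam a X y (W 0) := by
  have hstay : ∀ t ∈ Set.Icc 0 T, ∀ j, ‖W t j - W 0 j‖ < ρ j := by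
    by_contra hcon
    -- the set of times at which some node has reached its radius is compact
    set V : Set ℝ := ⋃ j, {t ∈ Set.Icc 0 T | ‖W t j - W 0 j‖ ∈ Set.Ici (ρ j)} with hV
    have hVc : IsCompact V := by
      refine isCompact_iUnion fun j => isCompact_Icc.of_isClosed_subset ?_ fun t ht => ht.1
      have hc : ContinuousOn (fun t => ‖W t j - W 0 j‖) (Set.Icc 0 T) := by
        have := (hW.absCont j T hT).continuousOn
        rw [Set.uIcc_of_le hT] at this
        exact (this.sub continuousOn_const).norm
      exact hc.preimage_isClosed_of_isClosed isClosed_Icc isClosed_Ici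
    have hVne : V.Nonempty := by
      push Not at hcon
      obtain ⟨t, ht, j, hj⟩ := hcon
      exact ⟨t, Set.mem_iUnion.2 ⟨j, ht, hj⟩⟩
    obtain ⟨t₀, ht₀, hmin⟩ := hVc.exists_isLeast hVne
    obtain ⟨j, ht₀T, hj⟩ := Set.mem_iUnion.1 ht₀
    have hbefore : ∀ t ∈ Set.Ioo 0 t₀, ∀ j, ‖W t j - W 0 j‖ ≤ ρ j := by
      intro t ht j
      by_contra! hlt
      have : t₀ ≤ t := hmin (Set.mem_iUnion.2 ⟨j, ⟨ht.1.le, ht.2.le.trans ht₀T.2⟩, hlt.le⟩)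
      exact absurd ht.2 this.not_gt
    have := norm_drift_le hX hlam ha hW ht₀T.1 hμ0 (fun t ht => hμ (W t) (hbefore t ht)) j
    exact absurd (this.trans_lt (hρ j)) (not_lt.2 hj)
  refine ⟨fun j => (hstay T ⟨hT, le_rfl⟩ j).le, loss_le_exp hlam ha hW hT fun t ht => ?_⟩
  exact hμ (W t) fun j => (hstay t ⟨ht.1.le, ht.2.le⟩ j).le

/-! ### Gaussian weights, and positivity of the mean Gram matrix -/

lemma stdGaussian_map_inner (x : EuclideanSpace ℝ (Fin d)) :
    (stdGaussian (EuclideanSpace ℝ (Fin d))).map (fun w => inner ℝ w x) =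
      gaussianReal 0 (‖x‖ ^ 2).toNNReal := by
  have h := IsGaussian.map_eq_gaussianReal (μ := stdGaussian (EuclideanSpace ℝ (Fin d)))
    (innerSL ℝ x)
  rw [integral_strongDual_stdGaussian, variance_dual_stdGaussian, innerSL_apply_norm] at h
  rw [← h]
  congr 1
  ext w
  simp [real_inner_comm]

lemma integral_inner_sq_stdGaussian (x : EuclideanSpace ℝ (Fin d)) :
    ∫ w, (inner ℝ w x) ^ 2 ∂(stdGaussian (EuclideanSpace ℝ (Fin d))) = ‖x‖ ^ 2 := by
  have h := variance_dual_stdGaussian (E := EuclideanSpace ℝ (Fin d)) (innerSL ℝ x)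
  rw [variance_of_integral_eq_zero (by fun_prop) (integral_strongDual_stdGaussian _),
    innerSL_apply_norm] at h
  rw [← h]
  simp [real_inner_comm]

lemma memLp_inner_stdGaussian (x : EuclideanSpace ℝ (Fin d)) :
    MemLp (fun w => inner ℝ w x) 2 (stdGaussian (EuclideanSpace ℝ (Fin d))) := by
  have h := IsGaussian.memLp_dual (stdGaussian (EuclideanSpace ℝ (Fin d))) (innerSL ℝ x) 2
    (by norm_num)
  refine h.ae_eq (Filter.Eventually.of_forall fun w => ?_)
  simp [real_inner_comm]

/-- Gaussian small-ball estimate, from the bound `1 / √(2πv)` on the density. -/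
lemma stdGaussian_abs_inner_le (x : EuclideanSpace ℝ (Fin d)) (hx : 0 < ‖x‖) (R : ℝ) :
    stdGaussian (EuclideanSpace ℝ (Fin d)) {w | |inner ℝ w x| ≤ R * ‖x‖} ≤ ENNReal.ofReal R := by
  have hset : {w : EuclideanSpace ℝ (Fin d) | |inner ℝ w x| ≤ R * ‖x‖} =
      (fun w => inner ℝ w x) ⁻¹' Set.Icc (-(R * ‖x‖)) (R * ‖x‖) := by
    ext w; simp [abs_le]
  have hv : (‖x‖ ^ 2).toNNReal ≠ 0 := by
    rw [Ne, Real.toNNReal_eq_zero, not_le]; positivity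
  have hmeas : Measurable fun w : EuclideanSpace ℝ (Fin d) => inner ℝ w x := by fun_prop
  rw [hset, ← Measure.map_apply hmeas measurableSet_Icc, stdGaussian_map_inner,
    gaussianReal_apply _ hv]
  have hpdf : ∀ z, gaussianPDF 0 (‖x‖ ^ 2).toNNReal z ≤ ENNReal.ofReal (1 / (2 * ‖x‖)) := by
    intro z
    refine ENNReal.ofReal_le_ofReal ?_
    rw [gaussianPDFReal, Real.coe_toNNReal _ (by positivity)]
    have h1 : (√(2 * Real.pi * ‖x‖ ^ 2))⁻¹ ≤ 1 / (2 * ‖x‖) := by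
      rw [one_div]
      refine inv_anti₀ (by positivity) (Real.le_sqrt_of_sq_le ?_)
      nlinarith [Real.pi_gt_three, sq_nonneg ‖x‖]
    have h2 : Real.exp (-(z - 0) ^ 2 / (2 * ‖x‖ ^ 2)) ≤ 1 := by
      rw [Real.exp_le_one_iff]
      exact div_nonpos_of_nonpos_of_nonneg (by nlinarith [sq_nonneg (z - 0)]) (by positivity)
    calc _ ≤ 1 / (2 * ‖x‖) * 1 := mul_le_mul h1 h2 (Real.exp_pos _).le (by positivity)
      _ = _ := mul_one _
  calc ∫⁻ z in Set.Icc (-(R * ‖x‖)) (R * ‖x‖), gaussianPDF 0 (‖x‖ ^ 2).toNNReal z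
      ≤ ∫⁻ _ in Set.Icc (-(R * ‖x‖)) (R * ‖x‖), ENNReal.ofReal (1 / (2 * ‖x‖)) :=
        lintegral_mono fun z => hpdf z
    _ = ENNReal.ofReal R := by
        rw [setLIntegral_const, Real.volume_Icc, ← ENNReal.ofReal_mul (by positivity)]
        congr 1
        field_simp
        ring

instance isOpenPosMeasure_stdGaussian :
    (stdGaussian (EuclideanSpace ℝ (Fin d))).IsOpenPosMeasure := by
  have : (gaussianReal 0 1).IsOpenPosMeasure :=
    (gaussianReal_absolutelyContinuous' 0 one_ne_zero).isOpenPosMeasure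
  rw [← map_pi_eq_stdGaussian]
  exact (PiLp.continuous_toLp 2 _).isOpenPosMeasure_map (WithLp.toLp_surjective 2)

lemma measurable_reluDeriv : Measurable reluDeriv :=
  Measurable.ite measurableSet_Ioi measurable_const measurable_const

lemma measurable_relu : Measurable relu := measurable_const.max measurable_id

lemma measurable_preact (x : EuclideanSpace ℝ (Fin d)) :
    Measurable fun w : EuclideanSpace ℝ (Fin d) => preact w x := by
  unfold preact; fun_prop

lemma measurable_activePair (x x' : EuclideanSpace ℝ (Fin d)) :
    Measurable fun w : EuclideanSpace ℝ (Fin d) =>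
      reluDeriv (preact w x) * reluDeriv (preact w x') :=
  (measurable_reluDeriv.comp (measurable_preact x)).mul
    (measurable_reluDeriv.comp (measurable_preact x'))

lemma activePair_mem (z z' : ℝ) : reluDeriv z * reluDeriv z' ∈ Set.Icc (0 : ℝ) 1 := by
  have h := reluDeriv_mem z
  have h' := reluDeriv_mem z'
  exact ⟨mul_nonneg h.1 h'.1, mul_le_one₀ h.2 h'.1 h'.2⟩

lemma integrable_activePair (x x' : EuclideanSpace ℝ (Fin d)) :
    Integrable (fun w => reluDeriv (preact w x) * reluDeriv (preact w x'))
      (stdGaussian (EuclideanSpace ℝ (Fin d))) :=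
  Integrable.of_mem_Icc 0 1 (measurable_activePair x x').aemeasurable
    (Filter.Eventually.of_forall fun _ => activePair_mem _ _)

lemma meanNtg_isHermitian (X : Fin n → EuclideanSpace ℝ (Fin d)) : (meanNtg X).IsHermitian := by
  ext i i'
  simp only [meanNtg, Matrix.conjTranspose_apply, Matrix.of_apply, star_trivial]
  rw [real_inner_comm]
  simp only [mul_comm (reluDeriv (preact _ (X i')))]

lemma kappa_mul_le (X : Fin n → EuclideanSpace ℝ (Fin d)) (v : Fin n → ℝ) :
    kappa X * ∑ i, v i ^ 2 ≤ v ⬝ᵥ (meanNtg X).mulVec v :=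
  eigMin_mul_le (meanNtg_isHermitian X) v

/-- The combination of the data that a node with weight vector `w` sees. -/
def activeSum (X : Fin n → EuclideanSpace ℝ (Fin d)) (v : Fin n → ℝ)
    (w : EuclideanSpace ℝ (Fin d)) : EuclideanSpace ℝ (Fin d) :=
  ∑ i, (v i * reluDeriv (preact w (X i))) • X i

lemma norm_activeSum_sq (X : Fin n → EuclideanSpace ℝ (Fin d)) (v : Fin n → ℝ)
    (w : EuclideanSpace ℝ (Fin d)) :
    ‖activeSum X v w‖ ^ 2 = ∑ i, ∑ i', v i * (inner ℝ (X i) (X i') *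
      (reluDeriv (preact w (X i)) * reluDeriv (preact w (X i'))) * v i') := by
  rw [← real_inner_self_eq_norm_sq, activeSum]
  simp only [sum_inner, inner_sum, real_inner_smul_left, real_inner_smul_right]
  rw [Finset.sum_comm]
  refine Finset.sum_congr rfl fun i _ => Finset.sum_congr rfl fun i' _ => ?_
  rw [real_inner_comm]
  ring

lemma integrable_norm_activeSum_sq (X : Fin n → EuclideanSpace ℝ (Fin d)) (v : Fin n → ℝ) :
    Integrable (fun w => ‖activeSum X v w‖ ^ 2) (stdGaussian (EuclideanSpace ℝ (Fin d))) := by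
  simp only [norm_activeSum_sq]
  exact integrable_finsetSum _ fun i _ => integrable_finsetSum _ fun i' _ =>
    (((integrable_activePair _ _).const_mul _).mul_const _).const_mul _

lemma meanNtg_quad (X : Fin n → EuclideanSpace ℝ (Fin d)) (v : Fin n → ℝ) :
    v ⬝ᵥ (meanNtg X).mulVec v =
      (1 / (d : ℝ)) * ∫ w, ‖activeSum X v w‖ ^ 2 ∂(stdGaussian (EuclideanSpace ℝ (Fin d))) := by
  simp only [norm_activeSum_sq]
  rw [integral_finsetSum _ fun i _ => integrable_finsetSum _ fun i' _ =>
    (((integrable_activePair _ _).const_mul _).mul_const _).const_mul _]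
  simp only [dotProduct, Matrix.mulVec, meanNtg, Matrix.of_apply, Finset.mul_sum]
  refine Finset.sum_congr rfl fun i _ => ?_
  rw [integral_finsetSum _ fun i' _ =>
    (((integrable_activePair _ _).const_mul _).mul_const _).const_mul _, Finset.mul_sum]
  refine Finset.sum_congr rfl fun i' _ => ?_
  rw [integral_const_mul, integral_mul_const, integral_const_mul]
  ring

/-- If the data are pairwise non-parallel, some point lies on the hyperplane orthogonal to `X i₀`
and on none of the other hyperplanes. -/
lemma exists_inner_eq_zero_forall_ne (X : Fin n → EuclideanSpace ℝ (Fin d))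
    (hXpar : ∀ i i', i ≠ i' → ∀ c : ℝ, X i ≠ c • X i') (i₀ : Fin n) (h0 : 0 < ‖X i₀‖) :
    ∃ w, inner ℝ w (X i₀) = (0 : ℝ) ∧ ∀ i ≠ i₀, inner ℝ w (X i) ≠ (0 : ℝ) := by
  set z : Fin n → EuclideanSpace ℝ (Fin d) := fun i =>
    X i - (inner ℝ (X i₀) (X i) / ‖X i₀‖ ^ 2) • X i₀ with hz
  set p : {i // i ≠ i₀} → Submodule ℝ (EuclideanSpace ℝ (Fin d)) :=
    fun i => (Submodule.span ℝ {z i})ᗮ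
  obtain ⟨w, hw⟩ : ∃ w, ∀ i, w ∉ p i := by
    by_contra! hcon
    obtain ⟨i, hi⟩ := Subspace.exists_eq_top_of_iUnion_eq_univ (p := p)
      (Set.eq_univ_of_forall fun w => by
        obtain ⟨i, hi⟩ := hcon w
        exact Set.mem_iUnion.2 ⟨i, hi⟩)
    have : z i = 0 := by
      have h1 : z i ∈ p i := by rw [hi]; trivial
      rw [Submodule.mem_orthogonal_singleton_iff_inner_right] at h1
      exact inner_self_eq_zero.1 h1
    exact hXpar i i₀ i.2 _ (sub_eq_zero.1 this)
  have hsq : ‖X i₀‖ ^ 2 ≠ 0 := by positivity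
  refine ⟨w - (inner ℝ w (X i₀) / ‖X i₀‖ ^ 2) • X i₀, ?_, fun i hi h => hw ⟨i, hi⟩ ?_⟩
  · rw [inner_sub_left, real_inner_smul_left, real_inner_self_eq_norm_sq]
    field_simp
    ring
  · rw [Submodule.mem_orthogonal_singleton_iff_inner_left]
    rw [inner_sub_left, real_inner_smul_left] at h
    simp only [hz, inner_sub_right, real_inner_smul_right]
    rw [← h]
    ring

lemma reluDeriv_preact_of_pos (hd : 1 ≤ d) {w x : EuclideanSpace ℝ (Fin d)}
    (h : 0 < inner ℝ w x) : reluDeriv (preact w x) = 1 := by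
  have : (0 : ℝ) < 1 / √(d : ℝ) := by positivity
  exact if_pos (mul_pos this h)

lemma reluDeriv_preact_of_neg (hd : 1 ≤ d) {w x : EuclideanSpace ℝ (Fin d)}
    (h : inner ℝ w x < 0) : reluDeriv (preact w x) = 0 := by
  have : (0 : ℝ) < 1 / √(d : ℝ) := by positivity
  exact if_neg (mul_neg_of_pos_of_neg this h).le.not_gt

/-- The functions `w ↦ x_i 1_{wᵀ x_i > 0}` are linearly independent for non-parallel data: crossing
the hyperplane of a single `X i₀` changes the combination by `v i₀ • X i₀`. -/
lemma eq_zero_of_activeSum_ae_eq_zero (hd : 1 ≤ d) {X : Fin n → EuclideanSpace ℝ (Fin d)}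
    (hX0 : ∀ i, 0 < ‖X i‖) (hXpar : ∀ i i', i ≠ i' → ∀ c : ℝ, X i ≠ c • X i') {v : Fin n → ℝ}
    (h : ∀ᵐ w ∂(stdGaussian (EuclideanSpace ℝ (Fin d))), activeSum X v w = 0) : v = 0 := by
  funext i₀
  obtain ⟨w₀, hw0, hw⟩ := exists_inner_eq_zero_forall_ne X hXpar i₀ (hX0 i₀)
  -- on either side of the hyperplane there is a point where the combination vanishes
  have hside : ∀ ε : ℝ, ε ≠ 0 → ∃ w, 0 < ε * inner ℝ w (X i₀) ∧
      (∀ i ≠ i₀, 0 < inner ℝ w₀ (X i) * inner ℝ w (X i)) ∧ activeSum X v w = 0 := by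
    intro ε hε
    set A : Set (EuclideanSpace ℝ (Fin d)) := {w | 0 < ε * inner ℝ w (X i₀) ∧
      ∀ i ≠ i₀, 0 < inner ℝ w₀ (X i) * inner ℝ w (X i)} with hA
    have hAo : IsOpen A := by
      have : A = {w | 0 < ε * inner ℝ w (X i₀)} ∩
          ⋂ i, ⋂ (_ : i ≠ i₀), {w | 0 < inner ℝ w₀ (X i) * inner ℝ w (X i)} := by
        ext w; simp [hA]
      rw [this]
      refine (isOpen_lt continuous_const (by fun_prop)).inter ?_
      exact isOpen_iInter_of_finite fun i => isOpen_iInter_of_finite fun _ =>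
        isOpen_lt continuous_const (by fun_prop)
    have hAne : A.Nonempty := by
      have hev : ∀ᶠ t in nhdsWithin (0 : ℝ) (Set.Ioi 0), ∀ i, i ≠ i₀ →
          0 < inner ℝ w₀ (X i) * inner ℝ (w₀ + t • (ε • X i₀)) (X i) := by
        rw [Filter.eventually_all]
        intro i
        by_cases hi : i = i₀
        · exact Filter.Eventually.of_forall fun t h => absurd hi h
        · have hc : Continuous fun t : ℝ =>
              inner ℝ w₀ (X i) * inner ℝ (w₀ + t • (ε • X i₀)) (X i) := by fun_prop
          have h0 : 0 < inner ℝ w₀ (X i) * inner ℝ (w₀ + (0 : ℝ) • (ε • X i₀)) (X i) := by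
            rw [zero_smul, add_zero]
            exact mul_self_pos.2 (hw i hi)
          filter_upwards [nhdsWithin_le_nhds (hc.continuousAt.eventually_const_lt h0)] with t ht _
          exact ht
      obtain ⟨t, ht, ht0⟩ := (hev.and self_mem_nhdsWithin).exists
      refine ⟨w₀ + t • (ε • X i₀), ?_, ht⟩
      rw [inner_add_left, hw0, zero_add, real_inner_smul_left, real_inner_smul_left,
        real_inner_self_eq_norm_sq]
      have h1 := hX0 i₀
      have h2 : 0 < ε * ε := mul_self_pos.2 hε
      have h3 : (0 : ℝ) < t := ht0
      calc 0 < (ε * ε) * (t * ‖X i₀‖ ^ 2) := by positivity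
        _ = _ := by ring
    have hpos := hAo.measure_pos (stdGaussian (EuclideanSpace ℝ (Fin d))) hAne
    obtain ⟨w, hwA, hwz⟩ := Measure.exists_mem_of_measure_ne_zero_of_ae hpos.ne'
      (ae_restrict_of_ae h)
    exact ⟨w, hwA.1, hwA.2, hwz⟩
  obtain ⟨w₁, h11, h12, h13⟩ := hside 1 one_ne_zero
  obtain ⟨w₂, h21, h22, h23⟩ := hside (-1) (by norm_num)
  have hdiff : activeSum X v w₁ - activeSum X v w₂ = v i₀ • X i₀ := by
    unfold activeSum
    rw [← Finset.sum_sub_distrib, Finset.sum_eq_single i₀]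
    · rw [reluDeriv_preact_of_pos hd (by linarith), reluDeriv_preact_of_neg hd (by linarith)]
      simp
    · intro i _ hi
      have a1 := h12 i hi
      have a2 := h22 i hi
      rcases lt_or_gt_of_ne (hw i hi) with hneg | hpos
      · rw [reluDeriv_preact_of_neg hd (neg_of_mul_pos_right a1 hneg.le),
          reluDeriv_preact_of_neg hd (neg_of_mul_pos_right a2 hneg.le), sub_self]
      · rw [reluDeriv_preact_of_pos hd ((mul_pos_iff_of_pos_left hpos).1 a1),
          reluDeriv_preact_of_pos hd ((mul_pos_iff_of_pos_left hpos).1 a2), sub_self]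
    · simp
  rw [h13, h23, sub_zero] at hdiff
  exact (smul_eq_zero.1 hdiff.symm).resolve_right (norm_pos_iff.1 (hX0 i₀))

/-- The minimum eigenvalue of the mean Gram matrix is positive for non-parallel data. -/
theorem kappa_pos (hn : 1 ≤ n) (hd : 1 ≤ d) {X : Fin n → EuclideanSpace ℝ (Fin d)}
    (hX0 : ∀ i, 0 < ‖X i‖) (hXpar : ∀ i i', i ≠ i' → ∀ c : ℝ, X i ≠ c • X i') :
    0 < kappa X := by
  have : Nonempty (Fin n) := ⟨⟨0, hn⟩⟩
  have hH := meanNtg_isHermitian X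
  have hpd : (meanNtg X).PosDef := by
    refine Matrix.PosDef.of_dotProduct_mulVec_pos hH fun v hv => ?_
    rw [star_trivial, meanNtg_quad]
    refine mul_pos (by positivity) ?_
    refine (integral_nonneg fun w => by positivity).lt_of_ne fun h0 => hv ?_
    have h1 := (integral_eq_zero_iff_of_nonneg (fun w => by positivity)
      (integrable_norm_activeSum_sq X v)).1 h0.symm
    refine eq_zero_of_activeSum_ae_eq_zero hd hX0 hXpar ?_
    filter_upwards [h1] with w hw
    simpa using hw
  rw [kappa, eigMin, hH.spectrum_real_eq_range_eigenvalues]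
  obtain ⟨i, hi⟩ := (Set.range_nonempty hH.eigenvalues).csInf_mem (Set.finite_range _)
  rw [← hi]
  exact hpd.eigenvalues_pos i

lemma kappa_mul_dim_le_one (hn : 1 ≤ n) (hd : 1 ≤ d) {X : Fin n → EuclideanSpace ℝ (Fin d)}
    (hX1 : ∀ i, ‖X i‖ ≤ 1) : kappa X * d ≤ 1 := by
  set i₀ : Fin n := ⟨0, hn⟩
  have hd0 : (0 : ℝ) < d := by exact_mod_cast hd
  have h := kappa_mul_le X (Pi.single i₀ 1)
  have hs : ∑ i, (Pi.single i₀ 1 : Fin n → ℝ) i ^ 2 = 1 := by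
    rw [Finset.sum_eq_single i₀ (fun i _ hi => by simp [hi]) (by simp)]
    simp
  have hI : ∫ w, reluDeriv (preact w (X i₀)) * reluDeriv (preact w (X i₀))
      ∂(stdGaussian (EuclideanSpace ℝ (Fin d))) ≤ 1 := by
    calc _ ≤ ∫ _, (1 : ℝ) ∂(stdGaussian (EuclideanSpace ℝ (Fin d))) :=
          integral_mono (integrable_activePair _ _) (integrable_const _)
            fun w => (activePair_mem _ _).2
      _ = 1 := by simp
  have hI0 : 0 ≤ ∫ w, reluDeriv (preact w (X i₀)) * reluDeriv (preact w (X i₀))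
      ∂(stdGaussian (EuclideanSpace ℝ (Fin d))) :=
    integral_nonneg fun w => (activePair_mem _ _).1
  rw [hs, mul_one] at h
  simp only [Matrix.mulVec_single_one, Matrix.col_apply, single_dotProduct, one_mul, meanNtg,
    Matrix.of_apply] at h
  rw [real_inner_self_eq_norm_sq] at h
  have h1 : ‖X i₀‖ ^ 2 ≤ 1 := pow_le_one₀ (norm_nonneg _) (hX1 i₀)
  have h2 : 1 / (d : ℝ) * ‖X i₀‖ ^ 2 * (∫ w, reluDeriv (preact w (X i₀)) *
      reluDeriv (preact w (X i₀)) ∂(stdGaussian (EuclideanSpace ℝ (Fin d)))) ≤ 1 / d * 1 * 1 := by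
    gcongr
  rw [mul_one, mul_one] at h2
  rw [← le_div_iff₀ hd0]
  exact h.trans h2

/-! ### Probability bounds at initialisation -/

lemma integral_uniformOn_sign : ∫ x, x ∂(uniformOn ({-1, 1} : Set ℝ)) = 0 := by
  have hs : ({-1, 1} : Set ℝ) = (({-1, 1} : Finset ℝ) : Set ℝ) := by simp
  rw [uniformOn, ProbabilityTheory.cond, integral_smul_measure, hs,
    setIntegral_finset _ (by
      rw [← hs, Set.insert_eq]
      exact (integrableOn_singleton (hx := by simp)).union
        (integrableOn_singleton (hx := by simp))),
    Finset.sum_pair (by norm_num)]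
  simp [Measure.real]

section

variable {Ω : Type*} [MeasurableSpace Ω] {P : Measure Ω}

lemma measure_ge_le_of_integral_le [IsProbabilityMeasure P] {f : Ω → ℝ}
    (hf0 : ∀ ω, 0 ≤ f ω) (hf : Integrable f P)
    {K c : ℝ} (hK : ∫ ω, f ω ∂P ≤ K) (hc : 0 < c) :
    P {ω | c ≤ f ω} ≤ ENNReal.ofReal (K / c) := by
  have h := mul_meas_ge_le_integral_of_nonneg (Filter.Eventually.of_forall hf0) hf c
  rw [← ofReal_measureReal]
  refine ENNReal.ofReal_le_ofReal ?_
  rw [le_div_iff₀ hc, mul_comm]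
  exact h.trans hK

/-- Markov bound for the weighted number of pairs of a node and a data point for which the initial
pre-activation is close to the kink of the ReLU. -/
lemma measure_flips_ge_le [IsProbabilityMeasure P] {X : Fin n → EuclideanSpace ℝ (Fin d)}
    (hX0 : ∀ i, 0 < ‖X i‖)
    {w0 : Fin m → Ω → EuclideanSpace ℝ (Fin d)}
    (hw_law : ∀ j, HasLaw (w0 j) (stdGaussian (EuclideanSpace ℝ (Fin d))) P)
    {q R : Fin m → ℝ} (hq : ∀ j, 0 ≤ q j) (hR : ∀ j, 0 ≤ R j) {c : ℝ} (hc : 0 < c) :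
    P {ω | c ≤ ∑ j, q j * ∑ i, if |inner ℝ (w0 j ω) (X i)| ≤ R j * ‖X i‖ then (1 : ℝ) else 0} ≤
      ENNReal.ofReal (n * (∑ j, q j * R j) / c) := by
  set A : Fin m → Fin n → Set (EuclideanSpace ℝ (Fin d)) :=
    fun j i => {w | |inner ℝ w (X i)| ≤ R j * ‖X i‖} with hA
  have hAm : ∀ j i, MeasurableSet (A j i) := fun j i =>
    measurableSet_le (by fun_prop) measurable_const
  have hind : ∀ j i, (fun ω => if |inner ℝ (w0 j ω) (X i)| ≤ R j * ‖X i‖ then (1 : ℝ) else 0) =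
      ((A j i).indicator fun _ => (1 : ℝ)) ∘ (w0 j) := fun j i => by
    funext ω; simp [hA, Set.indicator_apply]
  have hInt : ∀ j i, Integrable
      (fun ω => if |inner ℝ (w0 j ω) (X i)| ≤ R j * ‖X i‖ then (1 : ℝ) else 0) P := fun j i => by
    refine Integrable.of_mem_Icc 0 1 ?_ (Filter.Eventually.of_forall fun ω => ?_)
    · rw [hind]
      exact (measurable_const.indicator (hAm j i)).comp_aemeasurable (hw_law j).aemeasurable
    · split_ifs <;> simp
  have hE : ∀ j i,
      ∫ ω, (if |inner ℝ (w0 j ω) (X i)| ≤ R j * ‖X i‖ then (1 : ℝ) else 0) ∂P ≤ R j := fun j i => by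
    rw [hind, (hw_law j).integral_comp (measurable_const.indicator (hAm j i)).aestronglyMeasurable,
      integral_indicator_const _ (hAm j i), smul_eq_mul, mul_one]
    exact ENNReal.toReal_le_of_le_ofReal (hR j) (stdGaussian_abs_inner_le (X i) (hX0 i) (R j))
  refine measure_ge_le_of_integral_le (fun ω => ?_) ?_ ?_ hc
  · refine Finset.sum_nonneg fun j _ => mul_nonneg (hq j) (Finset.sum_nonneg fun i _ => ?_)
    split_ifs <;> simp
  · exact integrable_finsetSum _ fun j _ => (integrable_finsetSum _ fun i _ => hInt j i).const_mul _
  · rw [integral_finsetSum _ fun j _ =>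
      (integrable_finsetSum _ fun i _ => hInt j i).const_mul _, Finset.mul_sum]
    refine Finset.sum_le_sum fun j _ => ?_
    rw [integral_const_mul, integral_finsetSum _ fun i _ => hInt j i, mul_left_comm]
    refine mul_le_mul_of_nonneg_left ((Finset.sum_le_sum fun i _ => hE j i).trans ?_) (hq j)
    simp

/-- Chebyshev bound for the empirical mean of a `[0, 1]`-valued function of the initial weights. -/
lemma measure_empirical_mean_le [IsProbabilityMeasure P] (hm : 1 ≤ m)
    {w0 : Fin m → Ω → EuclideanSpace ℝ (Fin d)}
    (hw_law : ∀ j, HasLaw (w0 j) (stdGaussian (EuclideanSpace ℝ (Fin d))) P)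
    (hw_indep : iIndepFun w0 P) {h : EuclideanSpace ℝ (Fin d) → ℝ} (hh : Measurable h)
    (hh01 : ∀ w, h w ∈ Set.Icc (0 : ℝ) 1) {ε : ℝ} (hε : 0 < ε) :
    P {ω | ε ≤ |∑ j, (1 / (m : ℝ)) * h (w0 j ω) -
      ∫ w, h w ∂(stdGaussian (EuclideanSpace ℝ (Fin d)))|} ≤ ENNReal.ofReal (1 / (m * ε ^ 2)) := by
  have hm0 : (0 : ℝ) < m := by exact_mod_cast hm
  set p := ∫ w, h w ∂(stdGaussian (EuclideanSpace ℝ (Fin d)))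
  have hae : ∀ j, AEMeasurable (h ∘ w0 j) P := fun j =>
    hh.comp_aemeasurable (hw_law j).aemeasurable
  have hL : ∀ j, MemLp (h ∘ w0 j) 2 P := fun j =>
    memLp_of_bounded (a := 0) (b := 1) (Filter.Eventually.of_forall fun ω => hh01 _)
      (hae j).aestronglyMeasurable 2
  have hvar : Var[∑ j, h ∘ w0 j; P] ≤ m := by
    rw [IndepFun.variance_sum (fun j _ => hL j) fun j _ k _ hjk =>
      (hw_indep.indepFun hjk).comp hh hh]
    calc ∑ j, Var[h ∘ w0 j; P] ≤ ∑ _j : Fin m, (1 : ℝ) := by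
          refine Finset.sum_le_sum fun j _ => ?_
          refine (variance_le_sq_of_bounded (a := 0) (b := 1)
            (Filter.Eventually.of_forall fun ω => hh01 _) (hae j)).trans (by norm_num)
      _ = m := by simp
  have hmean : P[∑ j, h ∘ w0 j] = m * p := by
    rw [show (∑ j, h ∘ w0 j) = fun ω => ∑ j, (h ∘ w0 j) ω from by funext ω; simp,
      integral_finsetSum _ fun j _ => (hL j).integrable (by norm_num)]
    rw [Finset.sum_congr rfl fun j _ => (hw_law j).integral_comp hh.aestronglyMeasurable]
    simp [p]
  have hch := meas_ge_le_variance_div_sq (memLp_finsetSum' Finset.univ fun j _ => hL j)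
    (mul_pos hm0 hε)
  rw [hmean] at hch
  refine (measure_mono fun ω hω => ?_).trans (hch.trans (ENNReal.ofReal_le_ofReal ?_))
  · simp only [Set.mem_ofPred_eq, Finset.sum_apply, Function.comp_apply] at hω ⊢
    have : ∑ j, h (w0 j ω) - m * p = m * (∑ j, (1 / (m : ℝ)) * h (w0 j ω) - p) := by
      rw [← Finset.mul_sum]; field_simp
    rw [this, abs_mul, abs_of_pos hm0]
    gcongr
  · calc Var[∑ j, h ∘ w0 j; P] / (m * ε) ^ 2 ≤ m / (m * ε) ^ 2 := by gcongr
      _ = _ := by field_simp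

section

variable {a : Fin m → Ω → ℝ} {w0 : Fin m → Ω → EuclideanSpace ℝ (Fin d)}

lemma ae_sign_sq_eq_one (ha_law : ∀ j, HasLaw (a j) (uniformOn ({-1, 1} : Set ℝ)) P) :
    ∀ᵐ ω ∂P, ∀ j, a j ω ^ 2 = 1 := by
  rw [ae_all_iff]
  intro j
  have hfin : ({-1, 1} : Set ℝ).Finite := by simp
  have h : ∀ᵐ x ∂(uniformOn ({-1, 1} : Set ℝ)), x ∈ ({-1, 1} : Set ℝ) :=
    ae_cond_mem hfin.measurableSet
  have h2 := ((ha_law j).ae_iff (p := fun x => x ∈ ({-1, 1} : Set ℝ))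
    (measurableSet_setOfPred.1 hfin.measurableSet)).2 h
  filter_upwards [h2] with ω hω
  rcases hω with h | h <;> rw [h] <;> norm_num

/-- The initial network output has second moment at most `1/d`: the signs are centred and
independent, so only the diagonal terms `λ_j E σ(Z_j)²` remain. -/
lemma integral_net_sq_le [IsProbabilityMeasure P] (hd : 1 ≤ d)
    {x : EuclideanSpace ℝ (Fin d)} (hx : ‖x‖ ≤ 1)
    {lam : Fin m → ℝ} (hlam : ∀ j, 0 ≤ lam j) (hlam1 : ∑ j, lam j ≤ 1)
    (ha_law : ∀ j, HasLaw (a j) (uniformOn ({-1, 1} : Set ℝ)) P)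
    (hw_law : ∀ j, HasLaw (w0 j) (stdGaussian (EuclideanSpace ℝ (Fin d))) P)
    (ha_indep : iIndepFun a P)
    (haw_indep : IndepFun (fun ω j => a j ω) (fun ω j => w0 j ω) P) :
    Integrable (fun ω => net lam (fun j => a j ω) (fun j => w0 j ω) x ^ 2) P ∧
      ∫ ω, net lam (fun j => a j ω) (fun j => w0 j ω) x ^ 2 ∂P ≤ 1 / d := by
  have hd0 : (0 : ℝ) < d := by exact_mod_cast hd
  set g : EuclideanSpace ℝ (Fin d) → ℝ := fun w => relu (preact w x) with hg
  have hgm : Measurable g := measurable_relu.comp (measurable_preact x)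
  have hgle : ∀ w, |g w| ≤ |(1 / √(d : ℝ)) * inner ℝ w x| := fun w => by
    simp only [hg, relu, preact]
    rw [abs_of_nonneg (le_max_left _ _)]
    exact max_le (abs_nonneg _) (le_abs_self _)
  have hgL : MemLp g 2 (stdGaussian (EuclideanSpace ℝ (Fin d))) :=
    ((memLp_inner_stdGaussian x).const_mul (1 / √(d : ℝ))).mono hgm.aestronglyMeasurable
      (Filter.Eventually.of_forall hgle)
  have hgsq : ∫ w, g w ^ 2 ∂(stdGaussian (EuclideanSpace ℝ (Fin d))) ≤ 1 / d := by
    calc ∫ w, g w ^ 2 ∂(stdGaussian (EuclideanSpace ℝ (Fin d)))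
        ≤ ∫ w, (1 / (d : ℝ)) * (inner ℝ w x) ^ 2 ∂(stdGaussian (EuclideanSpace ℝ (Fin d))) := by
          refine integral_mono hgL.integrable_sq
            ((memLp_inner_stdGaussian x).integrable_sq.const_mul _) fun w => ?_
          have := sq_le_sq.2 (hgle w)
          rwa [mul_pow, div_pow, one_pow, Real.sq_sqrt hd0.le] at this
      _ ≤ 1 / d := by
          rw [integral_const_mul, integral_inner_sq_stdGaussian]
          exact mul_le_of_le_one_right (by positivity) (pow_le_one₀ (norm_nonneg _) hx)
  have hGL : ∀ j, MemLp (fun ω => g (w0 j ω)) 2 P := fun j => by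
    have h1 : MemLp g 2 (P.map (w0 j)) := by rw [(hw_law j).map_eq]; exact hgL
    exact (memLp_map_measure_iff h1.aestronglyMeasurable (hw_law j).aemeasurable).1 h1
  have hsq := ae_sign_sq_eq_one ha_law
  have haL : ∀ j, MemLp (a j) 2 P := fun j => by
    refine MemLp.of_bound (ha_law j).aemeasurable.aestronglyMeasurable 1 ?_
    filter_upwards [hsq] with ω hω
    rw [Real.norm_eq_abs, ← sq_le_one_iff_abs_le_one]
    exact (hω j).le
  have hprod : ∀ j k, IndepFun (fun ω => a j ω * a k ω) (fun ω => g (w0 j ω) * g (w0 k ω)) P :=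
    fun j k => haw_indep.comp (φ := fun s : Fin m → ℝ => s j * s k)
      (ψ := fun u : Fin m → EuclideanSpace ℝ (Fin d) => g (u j) * g (u k))
      (by fun_prop) ((hgm.comp (measurable_pi_apply j)).mul (hgm.comp (measurable_pi_apply k)))
  have hInt : ∀ j k, Integrable (fun ω => (a j ω * a k ω) * (g (w0 j ω) * g (w0 k ω))) P :=
    fun j k => (hprod j k).integrable_mul ((haL j).integrable_mul (haL k))
      ((hGL j).integrable_mul (hGL k))
  have hE : ∀ j k, ∫ ω, (a j ω * a k ω) * (g (w0 j ω) * g (w0 k ω)) ∂P ≤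
      if j = k then 1 / (d : ℝ) else 0 := fun j k => by
    rw [(hprod j k).integral_fun_mul_eq_mul_integral
      ((haL j).integrable_mul (haL k)).aestronglyMeasurable
      ((hGL j).integrable_mul (hGL k)).aestronglyMeasurable]
    split_ifs with hjk
    · subst hjk
      have h1 : ∫ ω, a j ω * a j ω ∂P = 1 := by
        rw [integral_congr_ae (g := fun _ => (1 : ℝ))]
        · simp
        · filter_upwards [hsq] with ω hω
          rw [← sq]; exact hω j
      have h2 : ∫ ω, g (w0 j ω) * g (w0 j ω) ∂P =
          ∫ w, g w ^ 2 ∂(stdGaussian (EuclideanSpace ℝ (Fin d))) := by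
        have := (hw_law j).integral_comp (hgm.pow_const 2).aestronglyMeasurable
        rw [← this]
        simp [sq]
      rw [h1, h2, one_mul]
      exact hgsq
    · have h1 : ∫ ω, a j ω * a k ω ∂P = 0 := by
        rw [(ha_indep.indepFun hjk).integral_fun_mul_eq_mul_integral
          (haL j).aestronglyMeasurable (haL k).aestronglyMeasurable, (ha_law j).integral_eq,
          integral_uniformOn_sign, zero_mul]
      rw [h1, zero_mul]
  have hexp : ∀ ω, net lam (fun j => a j ω) (fun j => w0 j ω) x ^ 2 =
      ∑ j, ∑ k, (√(lam j) * √(lam k)) * ((a j ω * a k ω) * (g (w0 j ω) * g (w0 k ω))) := by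
    intro ω
    rw [sq, net, Finset.sum_mul_sum]
    exact Finset.sum_congr rfl fun j _ => Finset.sum_congr rfl fun k _ => by simp only [hg]; ring
  simp only [hexp]
  have hI1 : ∀ j, Integrable (fun ω => ∑ k, (√(lam j) * √(lam k)) *
      ((a j ω * a k ω) * (g (w0 j ω) * g (w0 k ω)))) P := fun j =>
    integrable_finsetSum _ fun k _ => (hInt j k).const_mul _
  refine ⟨integrable_finsetSum _ fun j _ => hI1 j, ?_⟩
  rw [integral_finsetSum _ fun j _ => hI1 j]
  calc _ ≤ ∑ j, lam j * (1 / d) := by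
        refine Finset.sum_le_sum fun j _ => ?_
        rw [integral_finsetSum _ fun k _ => (hInt j k).const_mul _]
        calc _ ≤ ∑ k, (√(lam j) * √(lam k)) * (if j = k then 1 / (d : ℝ) else 0) := by
              refine Finset.sum_le_sum fun k _ => ?_
              rw [integral_const_mul]
              exact mul_le_mul_of_nonneg_left (hE j k) (by positivity)
          _ = lam j * (1 / d) := by
              simp [Real.mul_self_sqrt (hlam j)]
    _ ≤ 1 / d := by
        rw [← Finset.sum_mul]
        exact mul_le_of_le_one_left (by positivity) hlam1

lemma two_mul_loss_le (X : Fin n → EuclideanSpace ℝ (Fin d)) {y : Fin n → ℝ} {C : ℝ}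
    (hy : ∀ i, |y i| ≤ C) (lam b : Fin m → ℝ) (W : Fin m → EuclideanSpace ℝ (Fin d)) :
    2 * loss lam b X y W ≤ ∑ i, (2 * C ^ 2 + 2 * net lam b W (X i) ^ 2) := by
  rw [loss, ← mul_assoc, mul_one_div_cancel two_ne_zero, one_mul]
  refine Finset.sum_le_sum fun i _ => ?_
  have h1 : y i ^ 2 ≤ C ^ 2 := sq_le_sq' (by linarith [(abs_le.1 (hy i)).1]) (abs_le.1 (hy i)).2
  nlinarith [sq_nonneg (y i + net lam b W (X i))]

/-- Markov bound for the initial loss, through the measurable upper bound of `two_mul_loss_le`. -/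
lemma measure_loss_ge_le [IsProbabilityMeasure P] (hd : 1 ≤ d)
    {X : Fin n → EuclideanSpace ℝ (Fin d)}
    (hX1 : ∀ i, ‖X i‖ ≤ 1) {y : Fin n → ℝ} {C : ℝ} (hy : ∀ i, |y i| ≤ C)
    {lam : Fin m → ℝ} (hlam : ∀ j, 0 ≤ lam j) (hlam1 : ∑ j, lam j ≤ 1)
    (ha_law : ∀ j, HasLaw (a j) (uniformOn ({-1, 1} : Set ℝ)) P)
    (hw_law : ∀ j, HasLaw (w0 j) (stdGaussian (EuclideanSpace ℝ (Fin d))) P)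
    (ha_indep : iIndepFun a P)
    (haw_indep : IndepFun (fun ω j => a j ω) (fun ω j => w0 j ω) P) {c : ℝ} (hc : 0 < c) :
    P {ω | c ≤ 2 * loss lam (fun j => a j ω) X y (fun j => w0 j ω)} ≤
      ENNReal.ofReal (n * D0 C d ^ 2 / c) := by
  have h := fun i => integral_net_sq_le hd (hX1 i) hlam hlam1 ha_law hw_law ha_indep haw_indep
  have hI : ∀ i, Integrable (fun ω =>
      2 * C ^ 2 + 2 * net lam (fun j => a j ω) (fun j => w0 j ω) (X i) ^ 2) P := fun i =>
    (integrable_const _).add ((h i).1.const_mul 2)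
  refine (measure_mono fun ω (hω : c ≤ _) => hω.trans (two_mul_loss_le X hy lam _ _)).trans
    (measure_ge_le_of_integral_le (fun ω => by positivity)
      (integrable_finsetSum _ fun i _ => hI i) ?_ hc)
  rw [integral_finsetSum _ fun i _ => hI i]
  calc _ ≤ ∑ _i : Fin n, D0 C d ^ 2 := by
        refine Finset.sum_le_sum fun i _ => ?_
        rw [integral_add (integrable_const _) ((h i).1.const_mul 2), D0,
          Real.sq_sqrt (by positivity), integral_const, integral_const_mul, probReal_univ, one_smul]
        have := (h i).2
        calc _ ≤ 2 * C ^ 2 + 2 * (1 / (d : ℝ)) := by gcongr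
          _ = _ := by ring
    _ = n * D0 C d ^ 2 := by simp

end

end

/-! ### Node scalings, and stability of the Gram matrix near the initial weights -/

section nodeScale

variable {γ : ℝ} {lamT : ℕ → ℝ}

lemma sum_lamT_pos (hm : 1 ≤ m) (hlam0 : ∀ j, 0 ≤ lamT j) (hlam_anti : Antitone lamT)
    (hlam_sum : HasSum lamT 1) : 0 < ∑ k : Fin m, lamT k := by
  have h0 : 0 < lamT 0 := by
    refine (hlam0 0).lt_of_ne fun h => ?_
    have hz : lamT = 0 := by
      funext j
      exact le_antisymm (by rw [Pi.zero_apply, h]; exact hlam_anti (Nat.zero_le j)) (hlam0 j)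
    rw [hz] at hlam_sum
    exact zero_ne_one (hasSum_zero.unique hlam_sum)
  exact Finset.sum_pos' (fun k _ => hlam0 k) ⟨⟨0, hm⟩, Finset.mem_univ _, h0⟩

lemma mul_one_div_le_nodeScale (hγ1 : γ ≤ 1) (hlam0 : ∀ j, 0 ≤ lamT j) (j : Fin m) :
    γ * (1 / m) ≤ nodeScale γ lamT m j := by
  have h : 0 ≤ (1 - γ) * (lamT j / ∑ k : Fin m, lamT k) :=
    mul_nonneg (by linarith) (div_nonneg (hlam0 _) (Finset.sum_nonneg fun k _ => hlam0 _))
  unfold nodeScale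
  linarith

lemma sum_nodeScale (hm : 1 ≤ m) (hlam0 : ∀ j, 0 ≤ lamT j) (hlam_anti : Antitone lamT)
    (hlam_sum : HasSum lamT 1) : ∑ j, nodeScale γ lamT m j = 1 := by
  have h := sum_lamT_pos hm hlam0 hlam_anti hlam_sum
  have hm0 : (m : ℝ) ≠ 0 := by positivity
  simp only [nodeScale, Finset.sum_add_distrib, ← Finset.mul_sum, ← Finset.sum_div]
  rw [div_self h.ne', Finset.sum_const, Finset.card_univ, Fintype.card_fin, nsmul_eq_mul,
    mul_one, div_self hm0]
  ring

end nodeScale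

/-- The activation pattern of the weights `W` on the data. -/
def pattern (X : Fin n → EuclideanSpace ℝ (Fin d)) (W : Fin m → EuclideanSpace ℝ (Fin d))
    (i : Fin n) (j : Fin m) : ℝ := reluDeriv (preact (W j) (X i))

lemma ntg_eq_wgram (lam : Fin m → ℝ) (X : Fin n → EuclideanSpace ℝ (Fin d))
    (W : Fin m → EuclideanSpace ℝ (Fin d)) : ntg lam X W = wgram lam X (pattern X W) := rfl

/-- The `q`-weighted number of pairs of a node `j` and a data point whose pre-activation at the
weights `W` can change sign when `W j` moves by at most `ρ j`. -/
def flips (q ρ : Fin m → ℝ) (X : Fin n → EuclideanSpace ℝ (Fin d))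
    (W : Fin m → EuclideanSpace ℝ (Fin d)) : ℝ :=
  ∑ j, q j * ∑ i, if |inner ℝ (W j) (X i)| ≤ ρ j * ‖X i‖ then (1 : ℝ) else 0

lemma abs_wgram_sub_pattern_le (hd : 1 ≤ d) {X : Fin n → EuclideanSpace ℝ (Fin d)}
    (hX : ∀ i, ‖X i‖ ≤ 1) {q ρ : Fin m → ℝ} (hq : ∀ j, 0 ≤ q j) (hq1 : ∑ j, q j ≤ 1)
    {W W' : Fin m → EuclideanSpace ℝ (Fin d)} (hW : ∀ j, ‖W' j - W j‖ ≤ ρ j)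
    {s : Fin n → Fin m → ℝ} (hs : ∀ i j, s i j ∈ reluSubdiff (preact (W' j) (X i)))
    (u v : Fin n → ℝ) :
    |u ⬝ᵥ (wgram q X s).mulVec v - u ⬝ᵥ (wgram q X (pattern X W)).mulVec v| ≤
      2 / d * √(n * flips q ρ X W) * (√(∑ i, u i ^ 2) * √(∑ i, v i ^ 2)) := by
  have h01 : ∀ z ∈ Set.Icc (0 : ℝ) 1, z ^ 2 ≤ 1 := fun z hz => pow_le_one₀ hz.1 hz.2
  refine (abs_wgram_sub_bilin_le hX hq hq1 (fun i j => h01 _ (reluSubdiff_subset _ (hs i j)))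
    (fun i j => h01 _ (reluDeriv_mem _)) u v).trans ?_
  unfold flips
  gcongr with j _ i
  · exact hq j
  · exact sq_sub_reluDeriv_le hd (hW j) (hs i j)

/-- If all pair frequencies of active nodes are close to their means, half of the minimum eigenvalue
of the mean Gram matrix survives in the equally weighted empirical one. -/
lemma half_kappa_le (hn : 1 ≤ n) (hd : 1 ≤ d) {X : Fin n → EuclideanSpace ℝ (Fin d)}
    (hX : ∀ i, ‖X i‖ ≤ 1) {W : Fin m → EuclideanSpace ℝ (Fin d)}
    (h : ∀ i i', |∑ j, (1 / (m : ℝ)) * (reluDeriv (preact (W j) (X i)) *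
        reluDeriv (preact (W j) (X i'))) -
      ∫ w, reluDeriv (preact w (X i)) * reluDeriv (preact w (X i'))
        ∂(stdGaussian (EuclideanSpace ℝ (Fin d)))| ≤ kappa X * d / (2 * n)) (v : Fin n → ℝ) :
    kappa X / 2 * ∑ i, v i ^ 2 ≤
      v ⬝ᵥ (wgram (fun _ : Fin m => 1 / (m : ℝ)) X (pattern X W)).mulVec v := by
  have hn0 : (0 : ℝ) < n := by exact_mod_cast hn
  have hd0 : (0 : ℝ) < d := by exact_mod_cast hd
  set E := wgram (fun _ : Fin m => 1 / (m : ℝ)) X (pattern X W) with hE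
  have hent : ∀ i i', |meanNtg X i i' - E i i'| ≤ kappa X / (2 * n) := by
    intro i i'
    have hin : |inner ℝ (X i) (X i')| ≤ (1 : ℝ) :=
      (abs_real_inner_le_norm _ _).trans (mul_le_one₀ (hX i) (norm_nonneg _) (hX i'))
    simp only [hE, meanNtg, wgram, pattern, Matrix.of_apply]
    rw [← mul_sub, abs_mul, abs_mul, abs_of_pos (by positivity : (0 : ℝ) < 1 / d), abs_sub_comm]
    simp only [mul_assoc (1 / (m : ℝ))]
    calc _ ≤ 1 / (d : ℝ) * 1 * (kappa X * d / (2 * n)) :=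
          mul_le_mul (by gcongr) (h i i') (abs_nonneg _) (by positivity)
      _ = _ := by field_simp
  have hdiff : v ⬝ᵥ (meanNtg X).mulVec v - v ⬝ᵥ E.mulVec v ≤ kappa X / 2 * ∑ i, v i ^ 2 := by
    have hcs : (∑ i, |v i|) ^ 2 ≤ n * ∑ i, v i ^ 2 := by
      have := sq_sum_le_card_mul_sum_sq (s := (Finset.univ : Finset (Fin n))) (f := fun i => |v i|)
      simpa using this
    have hk : 0 ≤ kappa X / (2 * n) :=
      (abs_nonneg _).trans (hent ⟨0, hn⟩ ⟨0, hn⟩)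
    calc v ⬝ᵥ (meanNtg X).mulVec v - v ⬝ᵥ E.mulVec v
        = ∑ i, ∑ i', v i * ((meanNtg X i i' - E i i') * v i') := by
          simp only [dotProduct, Matrix.mulVec, Finset.mul_sum, ← Finset.sum_sub_distrib]
          exact Finset.sum_congr rfl fun i _ => Finset.sum_congr rfl fun i' _ => by ring
      _ ≤ ∑ i, ∑ i', |v i| * (kappa X / (2 * n) * |v i'|) := by
          refine Finset.sum_le_sum fun i _ => Finset.sum_le_sum fun i' _ => ?_
          refine (le_abs_self _).trans ?_
          rw [abs_mul, abs_mul]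
          gcongr
          exact hent i i'
      _ = kappa X / (2 * n) * (∑ i, |v i|) ^ 2 := by
          rw [sq, Finset.sum_mul_sum, Finset.mul_sum]
          simp only [Finset.mul_sum]
          exact Finset.sum_congr rfl fun i _ => Finset.sum_congr rfl fun i' _ => by ring
      _ ≤ kappa X / (2 * n) * (n * ∑ i, v i ^ 2) := by gcongr
      _ = _ := by field_simp
  have := kappa_mul_le X v
  linarith

/-- The lower bound `κ / 2` at the initial weights degrades to `κ / 4` at most in a neighbourhood
with few possible changes of the activation pattern. The equal part `γ / m` of the node scalings suffices
for the lower bound, so large individual scalings do no harm. -/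
lemma quarter_kappa_le (hd : 1 ≤ d) {X : Fin n → EuclideanSpace ℝ (Fin d)}
    (hX : ∀ i, ‖X i‖ ≤ 1) {γ : ℝ} (hγ : 0 < γ) {lam ρ : Fin m → ℝ}
    (hlam : ∀ j, γ * (1 / m) ≤ lam j) {W W' : Fin m → EuclideanSpace ℝ (Fin d)}
    (hinit : ∀ v : Fin n → ℝ, kappa X / 2 * ∑ i, v i ^ 2 ≤
      v ⬝ᵥ (wgram (fun _ : Fin m => 1 / (m : ℝ)) X (pattern X W)).mulVec v)
    (hflips : 2 / d * √(n * flips (fun _ => 1 / (m : ℝ)) ρ X W) ≤ kappa X / 4)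
    (hW : ∀ j, ‖W' j - W j‖ ≤ ρ j)
    {s : Fin n → Fin m → ℝ} (hs : ∀ i j, s i j ∈ reluSubdiff (preact (W' j) (X i)))
    (v : Fin n → ℝ) :
    γ * kappa X / 4 * ∑ i, v i ^ 2 ≤ v ⬝ᵥ (wgram lam X s).mulVec v := by
  have hsum : ∑ _j : Fin m, 1 / (m : ℝ) ≤ 1 := by
    rw [Finset.sum_const, Finset.card_univ, Fintype.card_fin, nsmul_eq_mul, mul_one_div]
    exact div_self_le_one _
  have h1 := abs_wgram_sub_pattern_le hd hX (q := fun _ => 1 / (m : ℝ)) (fun _ => by positivity)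
    hsum hW hs v v
  have hv : 0 ≤ ∑ i, v i ^ 2 := by positivity
  rw [Real.mul_self_sqrt hv] at h1
  have h2 := h1.trans (mul_le_mul_of_nonneg_right hflips hv)
  have h3 := (abs_le.1 h2).1
  have h4 := mul_wgram_le (q' := fun _ => 1 / (m : ℝ)) hlam X s v
  have h5 := hinit v
  calc γ * kappa X / 4 * ∑ i, v i ^ 2 = γ * (kappa X / 4 * ∑ i, v i ^ 2) := by ring
    _ ≤ _ := mul_le_mul_of_nonneg_left (by linarith) hγ.le
    _ ≤ _ := h4

lemma specNorm_ntg_sub_le (hd : 1 ≤ d) {X : Fin n → EuclideanSpace ℝ (Fin d)}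
    (hX : ∀ i, ‖X i‖ ≤ 1) {lam ρ : Fin m → ℝ} (hlam : ∀ j, 0 ≤ lam j) (hlam1 : ∑ j, lam j ≤ 1)
    {W W' : Fin m → EuclideanSpace ℝ (Fin d)} (hW : ∀ j, ‖W' j - W j‖ ≤ ρ j) :
    specNorm (ntg lam X W' - ntg lam X W) ≤ 2 / d * √(n * flips lam ρ X W) := by
  refine specNorm_le (by positivity) fun u v => ?_
  rw [Matrix.sub_mulVec, dotProduct_sub]
  exact (le_abs_self _).trans (abs_wgram_sub_pattern_le hd hX hlam hlam1 hW
    (fun i j => reluDeriv_mem_reluSubdiff _) u v)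

lemma exists_measurableSet_of_bad {Ω : Type*} [MeasurableSpace Ω] {P : Measure Ω}
    [IsProbabilityMeasure P] {N : Set Ω} {δ : ℝ} (hδ : 0 ≤ δ) (hN : P N ≤ ENNReal.ofReal δ) :
    ∃ G, MeasurableSet G ∧ ENNReal.ofReal (1 - δ) ≤ P G ∧ ∀ ω ∈ G, ω ∉ N := by
  refine ⟨(toMeasurable P N)ᶜ, (measurableSet_toMeasurable _ _).compl, ?_,
    fun ω hω h => hω (subset_toMeasurable _ _ h)⟩
  rw [prob_compl_eq_one_sub (measurableSet_toMeasurable _ _), measure_toMeasurable,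
    ENNReal.ofReal_sub _ hδ, ENNReal.ofReal_one]
  exact tsub_le_tsub_left hN 1

/-! ### Comparison of the constants -/

/-- The radius coefficient: during training, node `j` stays within
`driftCoeff · √λ_j` of its initial weights. -/
def driftCoeff (n d : ℕ) (D κ γ δ : ℝ) : ℝ := 2 ^ 3 * n * D / (κ * √(d : ℝ) * γ * √δ)

section Constants

variable {D κ γ δ : ℝ}

lemma driftCoeff_pos (hn : 1 ≤ n) (hd : 1 ≤ d) (hD : 0 < D) (hκ : 0 < κ) (hγ : 0 < γ)
    (hδ : 0 < δ) : 0 < driftCoeff n d D κ γ δ := by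
  have hn0 : (0 : ℝ) < n := by exact_mod_cast hn
  have hd0 : (0 : ℝ) < d := by exact_mod_cast hd
  unfold driftCoeff
  positivity

lemma width_clear_denom (hd : 1 ≤ d) (hκ : 0 < κ) (hγ : 0 < γ) (hδ : 0 < δ)
    (hm : 2 ^ 35 * n ^ 6 * D ^ 2 / (κ ^ 6 * d ^ 5 * γ ^ 2 * δ ^ 5) ≤ (m : ℝ)) :
    2 ^ 35 * n ^ 6 * D ^ 2 ≤ m * (κ ^ 6 * d ^ 5 * γ ^ 2 * δ ^ 5) := by
  have hd0 : (0 : ℝ) < d := by exact_mod_cast hd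
  rwa [div_le_iff₀ (by positivity)] at hm

/-- The width makes the union bound over the `n²` Chebyshev estimates at accuracy `κ d / (2 n)`
at most `δ / 4`. -/
lemma chebyshev_width (hn : 1 ≤ n) (hd : 1 ≤ d) (hm0 : 1 ≤ m) (hκ : 0 < κ) (hκd : κ * d ≤ 1)
    (hγ : 0 < γ) (hγ1 : γ ≤ 1) (hδ : 0 < δ) (hδ1 : δ < 1) (hD : 2 / (d : ℝ) ≤ D ^ 2)
    (hm : 2 ^ 35 * n ^ 6 * D ^ 2 / (κ ^ 6 * d ^ 5 * γ ^ 2 * δ ^ 5) ≤ (m : ℝ)) :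
    n ^ 2 * (1 / (m * (κ * d / (2 * n)) ^ 2)) ≤ δ / 4 := by
  have hn0 : (1 : ℝ) ≤ n := by exact_mod_cast hn
  have hd0 : (0 : ℝ) < d := by exact_mod_cast hd
  have hmm : (0 : ℝ) < m := by exact_mod_cast hm0
  have h := width_clear_denom hd hκ hγ hδ hm
  rw [div_le_iff₀ hd0] at hD
  have h1 : 2 ^ 36 * (n : ℝ) ^ 6 ≤ m * ((κ * d) ^ 2 * δ) := by
    calc 2 ^ 36 * (n : ℝ) ^ 6 = 2 ^ 35 * n ^ 6 * 2 := by ring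
      _ ≤ 2 ^ 35 * n ^ 6 * (D ^ 2 * d) := by gcongr
      _ = (2 ^ 35 * n ^ 6 * D ^ 2) * d := by ring
      _ ≤ m * (κ ^ 6 * d ^ 5 * γ ^ 2 * δ ^ 5) * d := by gcongr
      _ = m * ((κ * d) ^ 2 * δ) * ((κ * d) ^ 4 * γ ^ 2 * δ ^ 4) := by ring
      _ ≤ m * ((κ * d) ^ 2 * δ) * (1 ^ 4 * 1 ^ 2 * 1 ^ 4) := by gcongr
      _ = _ := by ring
  have h2 : (n : ℝ) ^ 4 ≤ n ^ 6 := pow_le_pow_right₀ hn0 (by norm_num)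
  have h3 : 16 * (n : ℝ) ^ 4 ≤ m * ((κ * d) ^ 2 * δ) := by
    calc 16 * (n : ℝ) ^ 4 ≤ 2 ^ 36 * (n : ℝ) ^ 6 := by gcongr; norm_num
      _ ≤ _ := h1
  calc n ^ 2 * (1 / (m * (κ * d / (2 * n)) ^ 2)) = 4 * n ^ 4 / (m * (κ * d) ^ 2) := by
        field_simp
        ring
    _ ≤ δ / 4 := by
        rw [div_le_div_iff₀ (by positivity) (by norm_num)]
        linarith

/-- The width makes the perturbation of the equally weighted Gram matrix at most `κ / 4`, when the
count of changed derivatives is at four times its mean bound divided by `δ`. -/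
lemma flips_width (hn : 1 ≤ n) (hd : 1 ≤ d) (hm0 : 1 ≤ m) (hκ : 0 < κ)
    (hγ : 0 < γ) (hδ : 0 < δ) (hδ1 : δ < 1) (hD : 0 < D)
    (hm : 2 ^ 35 * n ^ 6 * D ^ 2 / (κ ^ 6 * d ^ 5 * γ ^ 2 * δ ^ 5) ≤ (m : ℝ))
    {lam : Fin m → ℝ} (hlam : ∀ j, 0 ≤ lam j) (hlam1 : ∑ j, lam j ≤ 1) :
    2 / d * √(n * (4 * n * (∑ j, 1 / (m : ℝ) * (driftCoeff n d D κ γ δ * √(lam j))) / δ)) ≤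
      κ / 4 := by
  have hn0 : (0 : ℝ) < n := by exact_mod_cast hn
  have hd0 : (0 : ℝ) < d := by exact_mod_cast hd
  have hmm : (0 : ℝ) < m := by exact_mod_cast hm0
  have hB := driftCoeff_pos hn hd hD hκ hγ hδ
  set B := driftCoeff n d D κ γ δ with hBdef
  -- by Cauchy–Schwarz the average of `√λ_j` is at most `1 / √m`
  have hsum : ∑ j, √(lam j) ≤ √m := by
    refine Real.le_sqrt_of_sq_le ?_
    have h := sq_sum_le_card_mul_sum_sq (s := (Finset.univ : Finset (Fin m)))
      (f := fun j => √(lam j))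
    rw [Finset.card_univ, Fintype.card_fin,
      Finset.sum_congr rfl fun j _ => Real.sq_sqrt (hlam j)] at h
    exact h.trans (mul_le_of_le_one_right hmm.le hlam1)
  have hsm : √(m : ℝ) * √m = m := Real.mul_self_sqrt hmm.le
  have hsm0 : 0 < √(m : ℝ) := Real.sqrt_pos.2 hmm
  have havg : ∑ j, 1 / (m : ℝ) * (B * √(lam j)) ≤ B / √m := by
    rw [← Finset.mul_sum, ← Finset.mul_sum]
    calc 1 / (m : ℝ) * (B * ∑ j, √(lam j)) ≤ 1 / m * (B * √m) := by gcongr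
      _ = B / √m := by
          rw [← hsm]
          field_simp
          rw [Real.sqrt_sq hsm0.le]
  have hsd : √(d : ℝ) ^ 2 = d := Real.sq_sqrt hd0.le
  have hsδ : √δ ^ 2 = δ := Real.sq_sqrt hδ.le
  have h := width_clear_denom hd hκ hγ hδ hm
  have hkey : 2 ^ 11 * n ^ 3 * D ≤ κ ^ 3 * d ^ 2 * √(d : ℝ) * γ * √δ * δ * √(m : ℝ) := by
    refine le_of_sq_le_sq ?_ (by positivity)
    calc (2 ^ 11 * n ^ 3 * D) ^ 2 = 2 ^ 22 * (n ^ 6 * D ^ 2) := by ring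
      _ ≤ 2 ^ 35 * (n ^ 6 * D ^ 2) := by gcongr <;> norm_num
      _ = 2 ^ 35 * n ^ 6 * D ^ 2 := by ring
      _ ≤ m * (κ ^ 6 * d ^ 5 * γ ^ 2 * δ ^ 5) := h
      _ = m * (κ ^ 6 * d ^ 5 * γ ^ 2 * (δ ^ 3 * δ ^ 2)) := by ring
      _ ≤ m * (κ ^ 6 * d ^ 5 * γ ^ 2 * (δ ^ 3 * 1 ^ 2)) := by gcongr
      _ = κ ^ 6 * d ^ 4 * √(d : ℝ) ^ 2 * γ ^ 2 * √δ ^ 2 * δ ^ 2 * √(m : ℝ) ^ 2 := by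
          rw [hsd, hsδ, Real.sq_sqrt hmm.le]; ring
      _ = _ := by ring
  have hbound : n * (4 * n * (∑ j, 1 / (m : ℝ) * (B * √(lam j))) / δ) ≤ (κ * d / 8) ^ 2 := by
    calc n * (4 * n * (∑ j, 1 / (m : ℝ) * (B * √(lam j))) / δ) ≤ n * (4 * n * (B / √m) / δ) := by
          gcongr
      _ = 2 ^ 5 * n ^ 3 * D / (κ * √(d : ℝ) * γ * √δ * δ * √m) := by
          rw [hBdef, driftCoeff]
          field_simp
          ring
      _ ≤ (κ * d / 8) ^ 2 := by
          rw [div_le_iff₀ (by positivity)]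
          have e : (κ * d / 8) ^ 2 * (κ * √(d : ℝ) * γ * √δ * δ * √m) =
              (κ ^ 3 * d ^ 2 * √(d : ℝ) * γ * √δ * δ * √(m : ℝ)) / 64 := by ring
          rw [e]
          linarith
  calc 2 / (d : ℝ) * √(n * (4 * n * (∑ j, 1 / (m : ℝ) * (B * √(lam j))) / δ))
      ≤ 2 / d * (κ * d / 8) := by
        gcongr
        exact (Real.sqrt_le_sqrt hbound).trans_eq (Real.sqrt_sq (by positivity))
    _ = κ / 4 := by field_simp; ring

/-- The strict inequality that closes the bootstrap argument, with `μ = γ κ / 4`. -/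
lemma drift_lt_radius (hn : 1 ≤ n) (hd : 1 ≤ d) (hκ : 0 < κ) (hγ : 0 < γ) (hδ : 0 < δ)
    (hD : 0 < D) {l L : ℝ} (hl : 0 < l) (hL : 2 * L < 4 * n * D ^ 2 / δ) :
    √l * √n / √d * √(2 * L) / (γ * κ / 4) < driftCoeff n d D κ γ δ * √l := by
  have hn0 : (0 : ℝ) < n := by exact_mod_cast hn
  have hd0 : (0 : ℝ) < d := by exact_mod_cast hd
  have h1 : √(2 * L) < 2 * √n * D / √δ := by
    rw [Real.sqrt_lt' (by positivity)]
    refine hL.trans_eq ?_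
    rw [div_pow, mul_pow, mul_pow, Real.sq_sqrt hn0.le, Real.sq_sqrt hδ.le]
    ring
  calc √l * √n / √d * √(2 * L) / (γ * κ / 4)
      < √l * √n / √d * (2 * √n * D / √δ) / (γ * κ / 4) := by gcongr
    _ = 2 ^ 3 * √n ^ 2 * D / (κ * √(d : ℝ) * γ * √δ) * √l := by field_simp; ring
    _ = _ := by rw [Real.sq_sqrt hn0.le, driftCoeff]

/-- Cauchy–Schwarz leads to a multiple of `√(∑_j λ_j^{3/2})` only, so the second summand on the
right alone is already an upper bound. -/
lemma specNorm_constant_le (hn : 1 ≤ n) (hd : 1 ≤ d) (hκ : 0 < κ) (hγ : 0 < γ) (hδ : 0 < δ)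
    (hδ1 : δ < 1) (hD : 0 < D) {lam : Fin m → ℝ} (hlam : ∀ j, 0 < lam j) :
    2 / d * √(n * (4 * n * (∑ j, lam j * (driftCoeff n d D κ γ δ * √(lam j))) / δ)) ≤
      2 ^ 9 * n ^ 2 * D / (κ * (d : ℝ) ^ (3 / 2 : ℝ) * γ * δ ^ (5 / 2 : ℝ)) *
          ∑ j, lam j ^ (3 / 2 : ℝ) +
        2 ^ 6 * (n : ℝ) ^ (3 / 2 : ℝ) * √D /
          (√κ * (d : ℝ) ^ (5 / 4 : ℝ) * √γ * δ ^ (5 / 4 : ℝ)) * √(∑ j, lam j ^ (3 / 2 : ℝ)) := by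
  have hn0 : (0 : ℝ) < n := by exact_mod_cast hn
  have hd0 : (0 : ℝ) < d := by exact_mod_cast hd
  have hS : ∑ j, lam j * (driftCoeff n d D κ γ δ * √(lam j)) =
      driftCoeff n d D κ γ δ * ∑ j, lam j ^ (3 / 2 : ℝ) := by
    rw [Finset.mul_sum]
    refine Finset.sum_congr rfl fun j _ => ?_
    rw [show (3 / 2 : ℝ) = 1 + 1 / 2 by norm_num, Real.rpow_add (hlam j), Real.rpow_one,
      ← Real.sqrt_eq_rpow]
    ring
  have hS0 : 0 ≤ ∑ j, lam j ^ (3 / 2 : ℝ) :=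
    Finset.sum_nonneg fun j _ => Real.rpow_nonneg (hlam j).le _
  set S := ∑ j, lam j ^ (3 / 2 : ℝ)
  rw [hS]
  have hfirst : 0 ≤ 2 ^ 9 * n ^ 2 * D / (κ * (d : ℝ) ^ (3 / 2 : ℝ) * γ * δ ^ (5 / 2 : ℝ)) * S := by
    positivity
  refine le_trans ?_ (le_add_of_nonneg_left hfirst)
  have en : ((n : ℝ) ^ (3 / 2 : ℝ)) ^ 2 = n ^ 3 := by
    rw [← Real.rpow_natCast, ← Real.rpow_mul hn0.le, ← Real.rpow_natCast]
    norm_num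
  have eq54 : ∀ z : ℝ, 0 < z → (z ^ (5 / 4 : ℝ)) ^ 2 = z ^ 2 * √z := fun z hz => by
    rw [← Real.rpow_natCast, ← Real.rpow_mul hz.le, Real.sqrt_eq_rpow, ← Real.rpow_natCast z 2,
      ← Real.rpow_add hz]
    norm_num
  refine le_of_sq_le_sq ?_ (by positivity)
  have hR : (2 ^ 6 * (n : ℝ) ^ (3 / 2 : ℝ) * √D /
      (√κ * (d : ℝ) ^ (5 / 4 : ℝ) * √γ * δ ^ (5 / 4 : ℝ)) * √S) ^ 2 =
      2 ^ 12 * n ^ 3 * D / (κ * (d ^ 2 * √d) * γ * (δ ^ 2 * √δ)) * S := by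
    rw [mul_pow, div_pow, mul_pow, mul_pow, mul_pow, mul_pow, mul_pow, en, eq54 _ hd0, eq54 _ hδ,
      Real.sq_sqrt hD.le, Real.sq_sqrt hκ.le, Real.sq_sqrt hγ.le, Real.sq_sqrt hS0]
    ring
  have hB := driftCoeff_pos hn hd hD hκ hγ hδ
  rw [hR, mul_pow, Real.sq_sqrt (by positivity), driftCoeff]
  calc _ = 2 ^ 7 * n ^ 3 * D / (κ * (d ^ 2 * √d) * γ * (δ ^ 2 * √δ)) * S * δ := by
        field_simp
        ring
    _ ≤ 2 ^ 12 * n ^ 3 * D / (κ * (d ^ 2 * √d) * γ * (δ ^ 2 * √δ)) * S * 1 := by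
        gcongr <;> norm_num
    _ = _ := mul_one _

end Constants

end AsymNet

end

theorem theorem1
    {n m d : ℕ} (hn : 1 ≤ n) (hd : 1 ≤ d)
    -- the dataset
    (X : Fin n → EuclideanSpace ℝ (Fin d)) (y : Fin n → ℝ) (C : ℝ)
    (hX0 : ∀ i, 0 < ‖X i‖) (hX1 : ∀ i, ‖X i‖ ≤ 1)
    (hXpar : ∀ i i', i ≠ i' → ∀ c : ℝ, X i ≠ c • X i')
    (hC : 0 < C) (hy : ∀ i, |y i| ≤ C)
    -- the node scalings
    (γ : ℝ) (hγ0 : 0 < γ) (hγ1 : γ ≤ 1)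
    (lamT : ℕ → ℝ) (hlam0 : ∀ j, 0 ≤ lamT j) (hlam_anti : Antitone lamT) (hlam_sum : HasSum lamT 1)
    -- the random output weights and the random initialisation
    {Ω : Type*} [MeasurableSpace Ω] (P : Measure Ω) [IsProbabilityMeasure P]
    (a : Fin m → Ω → ℝ) (w0 : Fin m → Ω → EuclideanSpace ℝ (Fin d))
    (ha_law : ∀ j, HasLaw (a j) (uniformOn ({-1, 1} : Set ℝ)) P)
    (hw_law : ∀ j, HasLaw (w0 j) (stdGaussian (EuclideanSpace ℝ (Fin d))) P)
    (ha_indep : iIndepFun a P) (hw_indep : iIndepFun w0 P)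
    (haw_indep : IndepFun (fun ω j => a j ω) (fun ω j => w0 j ω) P)
    -- the failure probability and the width
    (δ : ℝ) (hδ0 : 0 < δ) (hδ1 : δ < 1)
    (hm1 : 2 ^ 3 * n * Real.log (4 * n / δ) / (AsymNet.kappa X * d) ≤ (m : ℝ))
    (hm2 : 2 ^ 25 * n ^ 4 * AsymNet.D0 C d ^ 2 / (AsymNet.kappa X ^ 4 * d ^ 3 * γ ^ 2 * δ ^ 5)
      ≤ (m : ℝ))
    (hm3 : 2 ^ 35 * n ^ 6 * AsymNet.D0 C d ^ 2 / (AsymNet.kappa X ^ 6 * d ^ 5 * γ ^ 2 * δ ^ 5)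
      ≤ (m : ℝ)) :
    ∃ G : Set Ω, MeasurableSet G ∧ ENNReal.ofReal (1 - δ) ≤ P G ∧
      ∀ ω ∈ G, ∀ W : ℝ → Fin m → EuclideanSpace ℝ (Fin d),
        AsymNet.IsGradientFlow (AsymNet.nodeScale γ lamT m) (fun j => a j ω) X y W →
        (∀ j, W 0 j = w0 j ω) →
        ∀ t : ℝ, 0 ≤ t →
          γ * AsymNet.kappa X / 4
              ≤ AsymNet.eigMin (AsymNet.ntg (AsymNet.nodeScale γ lamT m) X (W t)) ∧
          AsymNet.loss (AsymNet.nodeScale γ lamT m) (fun j => a j ω) X y (W t)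
              ≤ Real.exp (-(γ * AsymNet.kappa X * t) / 2) *
                AsymNet.loss (AsymNet.nodeScale γ lamT m) (fun j => a j ω) X y (W 0) ∧
          (∀ j : Fin m, ‖W t j - W 0 j‖
              ≤ 2 ^ 3 * n * AsymNet.D0 C d / (AsymNet.kappa X * √(d : ℝ) * γ * √δ) *
                √(AsymNet.nodeScale γ lamT m j)) ∧
          AsymNet.specNorm (AsymNet.ntg (AsymNet.nodeScale γ lamT m) X (W t) -
                AsymNet.ntg (AsymNet.nodeScale γ lamT m) X (W 0))
              ≤ 2 ^ 9 * n ^ 2 * AsymNet.D0 C d /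
                  (AsymNet.kappa X * (d : ℝ) ^ (3 / 2 : ℝ) * γ * δ ^ (5 / 2 : ℝ)) *
                  ∑ j : Fin m, AsymNet.nodeScale γ lamT m j ^ (3 / 2 : ℝ) +
                2 ^ 6 * (n : ℝ) ^ (3 / 2 : ℝ) * √(AsymNet.D0 C d) /
                  (√(AsymNet.kappa X) * (d : ℝ) ^ (5 / 4 : ℝ) * √γ * δ ^ (5 / 4 : ℝ)) *
                  √(∑ j : Fin m, AsymNet.nodeScale γ lamT m j ^ (3 / 2 : ℝ)) := by
  set lam := AsymNet.nodeScale γ lamT m with hlamdef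
  set D := AsymNet.D0 C d with hDdef
  set κ := AsymNet.kappa X with hκdef
  have hn0 : (0 : ℝ) < n := by exact_mod_cast hn
  have hd0 : (0 : ℝ) < d := by exact_mod_cast hd
  have hκ : 0 < κ := AsymNet.kappa_pos hn hd hX0 hXpar
  have hD : 0 < D := Real.sqrt_pos.2 (by positivity)
  have hD2 : 2 / (d : ℝ) ≤ D ^ 2 := by
    rw [hDdef, AsymNet.D0, Real.sq_sqrt (by positivity)]
    nlinarith [sq_nonneg C]
  -- the required width is positive, so the case `m = 0` does not occur
  have hm : 1 ≤ m := by
    rw [Nat.one_le_iff_ne_zero]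
    rintro rfl
    refine absurd hm3 (not_le.2 ?_)
    rw [Nat.cast_zero]
    positivity
  have hm0 : (0 : ℝ) < m := by exact_mod_cast hm
  have hlamγ : ∀ j, γ * (1 / m) ≤ lam j := AsymNet.mul_one_div_le_nodeScale hγ1 hlam0
  have hlampos : ∀ j, 0 < lam j := fun j => lt_of_lt_of_le (by positivity) (hlamγ j)
  have hlam1 : ∑ j, lam j ≤ 1 := (AsymNet.sum_nodeScale hm hlam0 hlam_anti hlam_sum).le
  set ρ : Fin m → ℝ := fun j => AsymNet.driftCoeff n d D κ γ δ * √(lam j) with hρdef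
  have hρ : ∀ j, 0 < ρ j := fun j =>
    mul_pos (AsymNet.driftCoeff_pos hn hd hD hκ hγ0 hδ0) (Real.sqrt_pos.2 (hlampos j))
  have : Nonempty (Fin m) := ⟨⟨0, hm⟩⟩
  -- thresholds at four times the Markov bounds divided by `δ`: each failure costs at most `δ / 4`
  set c₂ : ℝ := 4 * n * D ^ 2 / δ with hc₂
  set c₃ : ℝ := 4 * n * (∑ j, lam j * ρ j) / δ with hc₃
  set c₄ : ℝ := 4 * n * (∑ j, 1 / (m : ℝ) * ρ j) / δ with hc₄
  have hS₃ : 0 < ∑ j, lam j * ρ j :=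
    Finset.sum_pos (fun j _ => mul_pos (hlampos j) (hρ j)) Finset.univ_nonempty
  have hS₄ : 0 < ∑ j, 1 / (m : ℝ) * ρ j :=
    Finset.sum_pos (fun j _ => mul_pos (by positivity) (hρ j)) Finset.univ_nonempty
  set ε : ℝ := κ * d / (2 * n) with hε
  set h : Fin n → Fin n → EuclideanSpace ℝ (Fin d) → ℝ := fun i i' w =>
    AsymNet.reluDeriv (AsymNet.preact w (X i)) * AsymNet.reluDeriv (AsymNet.preact w (X i')) with hh
  -- the failure events; they need not be measurable, as the sample maps are only a.e. measurable
  set N₀ : Set Ω := {ω | ¬ ∀ j, a j ω ^ 2 = 1} with hN₀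
  set N₁ : Set Ω := ⋃ i, ⋃ i', {ω | ε ≤ |∑ j, (1 / (m : ℝ)) * h i i' (w0 j ω) -
    ∫ w, h i i' w ∂(stdGaussian (EuclideanSpace ℝ (Fin d)))|} with hN₁
  set N₂ : Set Ω := {ω | c₂ ≤ 2 * AsymNet.loss lam (fun j => a j ω) X y (fun j => w0 j ω)} with hN₂
  set N₃ : Set Ω := {ω | c₃ ≤ AsymNet.flips lam ρ X (fun j => w0 j ω)} with hN₃
  set N₄ : Set Ω := {ω | c₄ ≤ AsymNet.flips (fun _ => 1 / (m : ℝ)) ρ X (fun j => w0 j ω)} with hN₄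
  have hP₀ : P N₀ = 0 := AsymNet.ae_sign_sq_eq_one ha_law
  have hP₁ : P N₁ ≤ ENNReal.ofReal (δ / 4) := by
    calc P N₁ ≤ ∑ _i : Fin n, ∑ _i' : Fin n, ENNReal.ofReal (1 / (m * ε ^ 2)) := by
          refine (measure_iUnion_fintype_le _ _).trans (Finset.sum_le_sum fun i _ => ?_)
          refine (measure_iUnion_fintype_le _ _).trans (Finset.sum_le_sum fun i' _ => ?_)
          exact AsymNet.measure_empirical_mean_le hm hw_law hw_indep
            (AsymNet.measurable_activePair _ _) (fun w => AsymNet.activePair_mem _ _)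
            (by positivity)
      _ = ENNReal.ofReal (n ^ 2 * (1 / (m * ε ^ 2))) := by
          rw [ENNReal.ofReal_mul (by positivity), ENNReal.ofReal_pow hn0.le, ENNReal.ofReal_natCast]
          simp only [Finset.sum_const, Finset.card_univ, Fintype.card_fin, nsmul_eq_mul]
          ring
      _ ≤ ENNReal.ofReal (δ / 4) := ENNReal.ofReal_le_ofReal
          (AsymNet.chebyshev_width hn hd hm hκ (AsymNet.kappa_mul_dim_le_one hn hd hX1) hγ0 hγ1
            hδ0 hδ1 hD2 hm3)
  have hP₂ : P N₂ ≤ ENNReal.ofReal (δ / 4) := by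
    refine (AsymNet.measure_loss_ge_le hd hX1 hy (fun j => (hlampos j).le) hlam1 ha_law hw_law
      ha_indep haw_indep (by positivity)).trans_eq ?_
    congr 1
    rw [← hDdef, hc₂]
    field_simp
  have hmarkov : ∀ S : ℝ, 0 < S → n * S / (4 * n * S / δ) = δ / 4 := fun S hS => by
    field_simp
  have hP₃ : P N₃ ≤ ENNReal.ofReal (δ / 4) := by
    refine (AsymNet.measure_flips_ge_le hX0 hw_law (fun j => (hlampos j).le)
      (fun j => (hρ j).le) (by positivity)).trans_eq ?_
    congr 1
    exact hmarkov _ hS₃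
  have hP₄ : P N₄ ≤ ENNReal.ofReal (δ / 4) := by
    refine (AsymNet.measure_flips_ge_le hX0 hw_law (fun j => by positivity)
      (fun j => (hρ j).le) (by positivity)).trans_eq ?_
    congr 1
    exact hmarkov _ hS₄
  have hPN : P (N₀ ∪ (N₁ ∪ N₂ ∪ (N₃ ∪ N₄))) ≤ ENNReal.ofReal δ := by
    calc P (N₀ ∪ (N₁ ∪ N₂ ∪ (N₃ ∪ N₄))) ≤ P N₀ + ((P N₁ + P N₂) + (P N₃ + P N₄)) := by
          refine (measure_union_le _ _).trans (add_le_add le_rfl ?_)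
          exact (measure_union_le _ _).trans
            (add_le_add (measure_union_le _ _) (measure_union_le _ _))
      _ ≤ 0 + ((ENNReal.ofReal (δ / 4) + ENNReal.ofReal (δ / 4)) +
            (ENNReal.ofReal (δ / 4) + ENNReal.ofReal (δ / 4))) := by
          rw [hP₀]; gcongr
      _ = ENNReal.ofReal δ := by
          rw [zero_add, ← ENNReal.ofReal_add (by positivity) (by positivity),
            ← ENNReal.ofReal_add (by positivity) (by positivity)]
          congr 1
          ring
  obtain ⟨G, hGm, hGP, hG⟩ := AsymNet.exists_measurableSet_of_bad hδ0.le hPN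
  refine ⟨G, hGm, hGP, fun ω hω W hW hW0 t ht => ?_⟩
  have hgood := hG ω hω
  simp only [Set.mem_union, not_or] at hgood
  obtain ⟨hg₀, ⟨hg₁, hg₂⟩, hg₃, hg₄⟩ := hgood
  have hW0' : W 0 = fun j => w0 j ω := funext hW0
  have ha : ∀ j, a j ω ^ 2 = 1 := not_not.1 hg₀
  have hinit : ∀ v : Fin n → ℝ, κ / 2 * ∑ i, v i ^ 2 ≤ v ⬝ᵥ (AsymNet.wgram
      (fun _ : Fin m => 1 / (m : ℝ)) X (AsymNet.pattern X (W 0))).mulVec v := by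
    refine AsymNet.half_kappa_le hn hd hX1 fun i i' => ?_
    rw [hW0']
    by_contra! hcon
    exact hg₁ (Set.mem_iUnion.2 ⟨i, Set.mem_iUnion.2 ⟨i', hcon.le⟩⟩)
  have hg₂' : 2 * AsymNet.loss lam (fun j => a j ω) X y (W 0) < c₂ := by
    rw [hW0']; exact not_le.1 hg₂
  have hg₃' : AsymNet.flips lam ρ X (W 0) ≤ c₃ := by
    rw [hW0']; exact (not_le.1 hg₃).le
  have hg₄' : AsymNet.flips (fun _ => 1 / (m : ℝ)) ρ X (W 0) ≤ c₄ := by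
    rw [hW0']; exact (not_le.1 hg₄).le
  have hflips : 2 / d * √(n * AsymNet.flips (fun _ => 1 / (m : ℝ)) ρ X (W 0)) ≤ κ / 4 :=
    le_trans (by gcongr) (AsymNet.flips_width hn hd hm hκ hγ0 hδ0 hδ1 hD hm3
      (fun j => (hlampos j).le) hlam1)
  have hμ : ∀ W' : Fin m → EuclideanSpace ℝ (Fin d), (∀ j, ‖W' j - W 0 j‖ ≤ ρ j) →
      ∀ s : Fin n → Fin m → ℝ,
      (∀ i j, s i j ∈ AsymNet.reluSubdiff (AsymNet.preact (W' j) (X i))) →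
      ∀ v : Fin n → ℝ, γ * κ / 4 * ∑ i, v i ^ 2 ≤ v ⬝ᵥ (AsymNet.wgram lam X s).mulVec v :=
    fun W' hW' s hs v =>
      AsymNet.quarter_kappa_le hd hX1 hγ0 hlamγ hinit hflips hW' hs v
  obtain ⟨hdrift, hloss⟩ := AsymNet.flow_stays hX1 (fun j => (hlampos j).le) ha hW
    (by positivity) (fun j => AsymNet.drift_lt_radius hn hd hκ hγ0 hδ0 hD (hlampos j) hg₂') hμ ht
  refine ⟨?_, ?_, hdrift, ?_⟩
  · rw [AsymNet.ntg_eq_wgram]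
    exact AsymNet.le_eigMin hn (AsymNet.wgram_isHermitian _ _ _)
      (hμ (W t) hdrift _ fun i j => AsymNet.reluDeriv_mem_reluSubdiff _)
  · refine hloss.trans_eq ?_
    congr 2
    ring
  · exact (AsymNet.specNorm_ntg_sub_le hd hX1 (fun j => (hlampos j).le) hlam1 hdrift).trans
      (le_trans (by gcongr)
        (AsymNet.specNorm_constant_le hn hd hκ hγ0 hδ0 hδ1 hD hlampos))
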